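/- Let $Q$ be a connected network with finitely many nodes and at least one but finitely many arcs; loops and parallel arcs are allowed, each arc $a$ is identified with an interval of positive length $\lambda(a)$, $Q$ carries the shortest-path metric $d$ and the length measure $\lambda$, and $\mu=\lambda(Q)$. Suppose that $Q$ has no leaf arc, i.e. no arc is incident to a node of degree $1$ (a loop contributes $2$ to the degree of its node). Let $g$ be the girth of $Q$, the minimum length of a circuit, where a circuit is a closed path consisting of distinct consecutively adjacent arcs ($g=\infty$ if there is no circuit), and let $0<\alpha\le g$. In the continuous patrolling game the Patroller chooses a patrol, a map $S:[0,\infty)\to Q$ with $d(S(t),S(t'))\le|t-t'|$ for all $t,t'\ge 0$, and the Attacker chooses a point $x\in Q$ and a starting time $\tau\ge 0$. The Patroller wins (payoff $1$) if $S(t)=x$ for some $t\in[\tau,\tau+\alpha]$; otherwise the payoff is $0$. Mixed strategies are probability measures on the set of patrols (with the $\sigma$-algebra generated by the evaluations $S\mapsto S(t)$) and on $Q\times[0,\infty)$ (with its Borel $\sigma$-algebra). The expected payoff is the interception probability when the two players choose independently. The game has value $V$ if its maximin and its minimax over mixed strategies are both equal to $V$; a mixed strategy is optimal if it guarantees $V$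 to the player using it. Then: 1. The game has a value, and it is $V=\alpha/\mu$. 2. For every $M\ge 0$, the uniform attack strategy, which attacks during $[M,M+\alpha]$ at a random point with distribution $\lambda/\mu$, is optimal for the Attacker. 3. There exist closed unit-speed tours $S_2:[0,2\mu]\to Q$ that traverse every arc exactly twice and in which, viewed cyclically, no arc is traversed twice consecutively in opposite directions. For every such tour $S_2$, its randomized periodic extension, i.e. the patrol $t\mapsto S_2((t+\Delta) \bmod 2\mu)$ with $\Delta$ uniformly distributed on $[0,2\mu]$, is optimal for the Patroller. -/

import Mathlib

open MeasureTheory Set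
open scoped NNReal ENNReal

noncomputable section

/-- A connected network: a multigraph with node set `V` and arc set `A` (loops and parallel arcs
are allowed) in which every arc `a` has a positive length. The arc `a` joins `src a` to `tgt a`;
this orientation only serves to fix a coordinate on the arc. -/
structure Network (V A : Type*) where
  src : A → V
  tgt : A → V
  length : A → ℝ
  length_pos : ∀ a, 0 < length a
  connected : ∀ u v : V, Relation.ReflTransGen
    (fun x y => ∃ a, (src a = x ∧ tgt a = y) ∨ (src a = y ∧ tgt a = x)) u v

namespace Network

variable {V A : Type*}

/-- The points of the network: its nodes, and the interior (regular) points of its arcs, where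
an arc `a` is an open interval of length `length a`. -/
inductive Point (Q : Network V A)
  | node (v : V) : Point Q
  | inner (a : A) (t : ℝ) (h0 : 0 < t) (h1 : t < Q.length a) : Point Q

/-- The point of the closed arc `a` at distance `t` from its source, for `0 ≤ t ≤ length a`
(the coordinate is clamped to that interval otherwise). -/
def arcPoint (Q : Network V A) (a : A) (t : ℝ) : Q.Point :=
  if h0 : t ≤ 0 then .node (Q.src a)
  else if h1 : Q.length a ≤ t then .node (Q.tgt a)
  else .inner a t (not_le.mp h0) (not_le.mp h1)

/-- `Q.IsPathLength x y r`: there is a path from `x` to `y` of length `r`, made of finitely many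
segments, each of which runs inside one closed arc. -/
inductive IsPathLength (Q : Network V A) : Q.Point → Q.Point → ℝ≥0∞ → Prop
  | nil (x : Q.Point) : IsPathLength Q x x 0
  | snoc {x : Q.Point} {r : ℝ≥0∞} {a : A} {s t : ℝ}
      (hs : s ∈ Icc 0 (Q.length a)) (ht : t ∈ Icc 0 (Q.length a))
      (h : IsPathLength Q x (Q.arcPoint a s) r) :
      IsPathLength Q x (Q.arcPoint a t) (r + edist s t)

theorem IsPathLength.trans {Q : Network V A} {x y z : Q.Point} {r r' : ℝ≥0∞}
    (h : Q.IsPathLength x y r) (h' : Q.IsPathLength y z r') : Q.IsPathLength x z (r + r') := by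
  induction h' with
  | nil => simpa using h
  | snoc hs ht _ ih => rw [← add_assoc]; exact .snoc hs ht ih

theorem IsPathLength.symm {Q : Network V A} {x y : Q.Point} {r : ℝ≥0∞}
    (h : Q.IsPathLength x y r) : Q.IsPathLength y x r := by
  induction h with
  | nil => exact .nil _
  | snoc hs ht _ ih =>
    have := (IsPathLength.snoc ht hs (.nil _)).trans ih
    rwa [zero_add, edist_comm, add_comm] at this

/-- The metric of the network: the infimum of the lengths of the paths between two points. -/
instance (Q : Network V A) : PseudoEMetricSpace Q.Point where
  edist x y := sInf {r | Q.IsPathLength x y r}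
  edist_self x := le_antisymm (sInf_le (.nil x)) bot_le
  edist_comm x y := by
    congr 1
    ext r
    exact ⟨IsPathLength.symm, IsPathLength.symm⟩
  edist_triangle x y z := by
    rw [ENNReal.sInf_add]
    refine le_iInf₂ fun r hr => ?_
    rw [add_comm, ENNReal.sInf_add]
    refine le_iInf₂ fun r' hr' => ?_
    rw [add_comm]
    exact sInf_le (IsPathLength.trans hr hr')

instance (Q : Network V A) : MeasurableSpace Q.Point := borel _

instance (Q : Network V A) : BorelSpace Q.Point := ⟨rfl⟩

theorem arcPoint_clamp (Q : Network V A) (a : A) (t : ℝ) :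
    Q.arcPoint a (max 0 (min t (Q.length a))) = Q.arcPoint a t := by
  have hp := Q.length_pos a
  unfold arcPoint
  rcases le_or_gt t 0 with h | h
  · simp [h]
  · rcases le_or_gt (Q.length a) t with h' | h'
    · simp [h', hp.le, hp.not_ge, h.not_ge]
    · simp [h.le, h'.le, h.not_ge, h'.not_ge]

theorem lipschitzWith_arcPoint (Q : Network V A) (a : A) : LipschitzWith 1 (Q.arcPoint a) := by
  intro s t
  have hm : ∀ u : ℝ, max 0 (min u (Q.length a)) ∈ Icc 0 (Q.length a) := fun u =>
    ⟨le_max_left _ _, max_le (Q.length_pos a).le (min_le_right _ _)⟩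
  have h := IsPathLength.snoc (hm s) (hm t) (.nil (Q.arcPoint a (max 0 (min s (Q.length a)))))
  rw [Q.arcPoint_clamp, Q.arcPoint_clamp, zero_add] at h
  refine (sInf_le h).trans ?_
  have hl : LipschitzWith 1 (fun u : ℝ => max 0 (min u (Q.length a))) :=
    (LipschitzWith.id.min_const _).const_max _
  exact hl s t

/-! ### Length -/

section Length

variable [Fintype A]

/-- Length as a measure on the network: Lebesgue measure on every arc. -/
def lengthMeasure (Q : Network V A) : Measure Q.Point :=
  ∑ a, (volume.restrict (Ioo 0 (Q.length a))).map (Q.arcPoint a)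

/-- The total length `μ` of the network. -/
def totalLength (Q : Network V A) : ℝ := ∑ a, Q.length a

theorem lengthMeasure_univ (Q : Network V A) :
    Q.lengthMeasure univ = ENNReal.ofReal Q.totalLength := by
  simp only [lengthMeasure, totalLength, Measure.finsetSum_apply]
  rw [ENNReal.ofReal_sum_of_nonneg fun a _ => (Q.length_pos a).le]
  refine Finset.sum_congr rfl fun a _ => ?_
  rw [Measure.map_apply (Q.lipschitzWith_arcPoint a).continuous.measurable MeasurableSet.univ]
  simp

theorem totalLength_pos [Nonempty A] (Q : Network V A) : 0 < Q.totalLength :=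
  Finset.sum_pos (fun a _ => Q.length_pos a) Finset.univ_nonempty

end Length

/-! ### Directed arcs, leaves, circuits and girth -/

/-- A directed arc: `(a, true)` is `a` traversed from `src a` to `tgt a`, and `(a, false)` is `a`
traversed in the opposite direction. A directed arc is also a passage at the node `tail` which it
leaves; a loop gives two passages at its node. -/
abbrev Dart (_ : Network V A) : Type _ := A × Bool

def tail (Q : Network V A) (d : Q.Dart) : V := if d.2 then Q.src d.1 else Q.tgt d.1

def head (Q : Network V A) (d : Q.Dart) : V := if d.2 then Q.tgt d.1 else Q.src d.1

def reverse (Q : Network V A) (d : Q.Dart) : Q.Dart := (d.1, !d.2)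

/-- The point reached after travelling the distance `s` along the directed arc `d`. -/
def dartPoint (Q : Network V A) (d : Q.Dart) (s : ℝ) : Q.Point :=
  if d.2 then Q.arcPoint d.1 s else Q.arcPoint d.1 (Q.length d.1 - s)

/-- The degree of a node: the number of passages at it. -/
def degree (Q : Network V A) (v : V) : ℕ := Nat.card {d : Q.Dart // Q.tail d = v}

/-- A leaf arc is an arc one of whose end nodes has degree one. -/
def IsLeafArc (Q : Network V A) (a : A) : Prop :=
  Q.degree (Q.src a) = 1 ∨ Q.degree (Q.tgt a) = 1

/-- A closed walk of `n + 1` directed arcs; the index `i + 1` is cyclic, so the last directed arc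
ends where the first one starts. -/
def IsClosedWalk (Q : Network V A) {n : ℕ} (d : Fin (n + 1) → Q.Dart) : Prop :=
  ∀ i, Q.head (d i) = Q.tail (d (i + 1))

/-- A circuit is a closed walk whose arcs are distinct. -/
def IsCircuit (Q : Network V A) {n : ℕ} (d : Fin (n + 1) → Q.Dart) : Prop :=
  Q.IsClosedWalk d ∧ Function.Injective fun i => (d i).1

/-- The girth: the minimum length of a circuit, and `∞` if there is none. -/
def girth (Q : Network V A) : ℝ≥0∞ :=
  ⨅ (n : ℕ) (d : Fin (n + 1) → Q.Dart) (_ : Q.IsCircuit d),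
    ENNReal.ofReal (∑ i, Q.length (d i).1)

/-! ### The patrolling game -/

/-- A patrol: a unit speed (1-Lipschitz) path defined for all times `t ≥ 0`. -/
def Patrol (Q : Network V A) : Type _ := {S : ℝ≥0 → Q.Point // LipschitzWith 1 S}

/-- Patrols carry the σ-algebra generated by the evaluations `S ↦ S t`. -/
instance (Q : Network V A) : MeasurableSpace Q.Patrol :=
  inferInstanceAs (MeasurableSpace {S : ℝ≥0 → Q.Point // LipschitzWith 1 S})

/-- A pure attack: the attacked point and the time at which the attack starts. -/
abbrev Attack (Q : Network V A) : Type _ := Q.Point × ℝ≥0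

/-- The patrol `S` intercepts an attack `(x, τ)` of duration `α` if it is at `x` at some time in
`[τ, τ + α]`. -/
def Intercepts (Q : Network V A) (α : ℝ) (S : Q.Patrol) (a : Q.Attack) : Prop :=
  ∃ t : ℝ≥0, (t : ℝ) ∈ Icc (a.2 : ℝ) (a.2 + α) ∧ S.1 t = a.1

/-- The expected payoff of mixed strategies: the probability of interception when the Patroller
and the Attacker choose independently. -/
def payoff (Q : Network V A) (α : ℝ) (σ : ProbabilityMeasure Q.Patrol)
    (ν : ProbabilityMeasure Q.Attack) : ℝ≥0∞ :=
  ((σ : Measure Q.Patrol).prod (ν : Measure Q.Attack)) {p | Q.Intercepts α p.1 p.2}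

/-- The maximin value of the game. -/
def lowerValue (Q : Network V A) (α : ℝ) : ℝ≥0∞ :=
  ⨆ σ : ProbabilityMeasure Q.Patrol, ⨅ ν : ProbabilityMeasure Q.Attack, Q.payoff α σ ν

/-- The minimax value of the game. -/
def upperValue (Q : Network V A) (α : ℝ) : ℝ≥0∞ :=
  ⨅ ν : ProbabilityMeasure Q.Attack, ⨆ σ : ProbabilityMeasure Q.Patrol, Q.payoff α σ ν

/-- The game has a value, and the value is `v`. -/
def HasValue (Q : Network V A) (α : ℝ) (v : ℝ≥0∞) : Prop :=
  Q.lowerValue α = v ∧ Q.upperValue α = v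

/-- A mixed patrol is optimal if it guarantees the value. -/
def IsOptimalPatrol (Q : Network V A) (α : ℝ) (σ : ProbabilityMeasure Q.Patrol) : Prop :=
  ∃ v, Q.HasValue α v ∧ ∀ ν : ProbabilityMeasure Q.Attack, v ≤ Q.payoff α σ ν

/-- A mixed attack is optimal if it holds the Patroller down to the value. -/
def IsOptimalAttack (Q : Network V A) (α : ℝ) (ν : ProbabilityMeasure Q.Attack) : Prop :=
  ∃ v, Q.HasValue α v ∧ ∀ σ : ProbabilityMeasure Q.Patrol, Q.payoff α σ ν ≤ v

/-- The uniform attack strategy with starting time `M`: the attacked point lies in a set `Y` with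
probability `lengthMeasure Y / totalLength`, and the attack starts at time `M`. -/
def uniformAttack [Fintype A] [Nonempty A] (Q : Network V A) (M : ℝ≥0) :
    ProbabilityMeasure Q.Attack :=
  ⟨((ENNReal.ofReal Q.totalLength)⁻¹ • Q.lengthMeasure).prod (Measure.dirac M), by
    have : IsProbabilityMeasure ((ENNReal.ofReal Q.totalLength)⁻¹ • Q.lengthMeasure) := ⟨by
      rw [Measure.smul_apply, Q.lengthMeasure_univ, smul_eq_mul]
      exact ENNReal.inv_mul_cancel (by simpa using Q.totalLength_pos) ENNReal.ofReal_ne_top⟩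
    infer_instance⟩

/-! ### Closed paths and their randomized periodic extensions -/

/-- A closed unit speed path `[0, L] → Q` (only the values of `toFun` on `[0, L]` matter). -/
structure ClosedPath (Q : Network V A) where
  L : ℝ
  L_pos : 0 < L
  toFun : ℝ → Q.Point
  lipschitz : LipschitzOnWith 1 toFun (Icc 0 L)
  closed : toFun 0 = toFun L

namespace ClosedPath

variable {Q : Network V A}

/-- The `L`-periodic extension `t ↦ S (t mod L)` of a closed path `S`. -/
def periodic (S : ClosedPath Q) (t : ℝ) : Q.Point := S.toFun (toIcoMod S.L_pos 0 t)

theorem lipschitz_glue {X : Type*} [PseudoEMetricSpace X] {f : ℝ → X} {a b c : ℝ}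
    (h₁ : LipschitzOnWith 1 f (Icc a b)) (h₂ : LipschitzOnWith 1 f (Icc b c)) :
    LipschitzOnWith 1 f (Icc a c) := by
  have key : ∀ x ∈ Icc a c, ∀ y ∈ Icc a c, x ≤ y → edist (f x) (f y) ≤ edist x y := by
    intro x hx y hy hxy
    rcases le_total y b with hb | hb
    · simpa using h₁ ⟨hx.1, hxy.trans hb⟩ ⟨hy.1, hb⟩
    rcases le_total b x with hb' | hb'
    · simpa using h₂ ⟨hb', hx.2⟩ ⟨hb, hy.2⟩
    have e₁ : edist (f x) (f b) ≤ edist x b := by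
      simpa using h₁ ⟨hx.1, hb'⟩ ⟨hx.1.trans hb', le_rfl⟩
    have e₂ : edist (f b) (f y) ≤ edist b y := by
      simpa using h₂ ⟨le_rfl, hb.trans hy.2⟩ ⟨hb, hy.2⟩
    refine (edist_triangle _ (f b) _).trans ((add_le_add e₁ e₂).trans_eq ?_)
    rw [edist_dist, edist_dist, edist_dist, ← ENNReal.ofReal_add dist_nonneg dist_nonneg,
      Real.dist_eq, Real.dist_eq, Real.dist_eq, abs_of_nonpos (by linarith),
      abs_of_nonpos (by linarith), abs_of_nonpos (by linarith)]
    congr 1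
    ring
  intro x hx y hy
  rw [ENNReal.coe_one, one_mul]
  rcases le_total x y with h | h
  · exact key x hx y hy h
  · rw [edist_comm, edist_comm x]
    exact key y hy x hx h

theorem periodic_eq (S : ClosedPath Q) (n : ℤ) {t : ℝ} (ht : t ∈ Icc (n * S.L) ((n + 1) * S.L)) :
    S.periodic t = S.toFun (t - n * S.L) := by
  unfold periodic
  rcases eq_or_lt_of_le ht.2 with h | h
  · have h1 : t = 0 + (n + 1 : ℤ) • S.L := by rw [h]; push_cast [zsmul_eq_mul]; ring
    have h2 : t - n * S.L = S.L := by rw [h]; ring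
    rw [h2, h1, toIcoMod_add_zsmul, toIcoMod_apply_left, S.closed]
  · congr 1
    rw [toIcoMod_eq_iff]
    refine ⟨⟨by linarith [ht.1], by linarith⟩, n, ?_⟩
    rw [zsmul_eq_mul]
    ring

theorem lipschitz_periodic (S : ClosedPath Q) : LipschitzWith 1 S.periodic := by
  have hL := S.L_pos
  have h1 : ∀ n : ℤ, LipschitzOnWith 1 S.periodic (Icc (n * S.L) ((n + 1) * S.L)) := by
    intro n x hx y hy
    rw [S.periodic_eq n hx, S.periodic_eq n hy]
    refine (S.lipschitz ⟨by linarith [hx.1], by linarith [hx.2]⟩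
      ⟨by linarith [hy.1], by linarith [hy.2]⟩).trans ?_
    rw [edist_sub_right]
  have h2 : ∀ n : ℕ, LipschitzOnWith 1 S.periodic (Icc (-(n * S.L)) (n * S.L)) := by
    intro n
    induction n with
    | zero =>
      intro x hx y hy
      have hx0 : x = 0 := by simpa using hx
      have hy0 : y = 0 := by simpa using hy
      simp [hx0, hy0]
    | succ n ih =>
      have e1 := h1 n
      have e2 := h1 (-(n + 1))
      push_cast at e1 e2 ⊢
      have e3 : (-((n : ℝ) + 1) + 1) * S.L = -(n * S.L) := by ring
      rw [neg_mul, e3] at e2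
      exact lipschitz_glue (lipschitz_glue e2 ih) e1
  intro x y
  obtain ⟨n, hn⟩ := exists_nat_ge (max |x| |y| / S.L)
  rw [div_le_iff₀ hL] at hn
  exact h2 n (abs_le.mp ((le_max_left _ _).trans hn)) (abs_le.mp ((le_max_right _ _).trans hn))

/-- The patrol `S_Δ : t ↦ S ((t + Δ) mod L)`. -/
def shift (S : ClosedPath Q) (Δ : ℝ) : Q.Patrol :=
  ⟨fun t => S.periodic (t + Δ), by
    intro s t
    refine (S.lipschitz_periodic (s + Δ) (t + Δ)).trans ?_
    rw [edist_add_right]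
    exact le_rfl⟩

theorem measurable_shift (S : ClosedPath Q) : Measurable S.shift := by
  refine Measurable.subtype_mk (measurable_pi_lambda _ fun t => ?_)
  exact (S.lipschitz_periodic.continuous.comp (continuous_const.add continuous_id)).measurable

/-- The randomized periodic extension of `S`: the patrol `S_Δ` with `Δ` uniform in `[0, L]`. -/
def randomizedExtension (S : ClosedPath Q) : ProbabilityMeasure Q.Patrol :=
  ⟨((ENNReal.ofReal S.L)⁻¹ • volume.restrict (Icc 0 S.L)).map S.shift, by
    have : IsProbabilityMeasure ((ENNReal.ofReal S.L)⁻¹ • volume.restrict (Icc 0 S.L)) := ⟨by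
      rw [Measure.smul_apply, Measure.restrict_apply_univ, Real.volume_Icc, sub_zero, smul_eq_mul]
      exact ENNReal.inv_mul_cancel (by simpa using S.L_pos) ENNReal.ofReal_ne_top⟩
    exact Measure.isProbabilityMeasure_map S.measurable_shift.aemeasurable⟩

/-- `S` goes once, at unit speed, through the cyclic sequence `d` of directed arcs. The path may
start anywhere on the way: the start of `d 0` is reached at time `c` (modulo `L`). -/
def Traverses (S : ClosedPath Q) {n : ℕ} (d : Fin (n + 1) → Q.Dart) : Prop :=
  S.L = ∑ i, Q.length (d i).1 ∧
    ∃ c : ℝ, ∀ i, ∀ s ∈ Icc 0 (Q.length (d i).1),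
      S.periodic (c + (∑ j ∈ Finset.Iio i, Q.length (d j).1) + s) = Q.dartPoint (d i) s

/-- `S` is a tour that traverses every arc exactly twice and never traverses an arc twice
consecutively in opposite directions (cyclically, so also not across the starting time). -/
def IsNonreversingDoubleCover (S : ClosedPath Q) : Prop :=
  ∃ (n : ℕ) (d : Fin (n + 1) → Q.Dart), Q.IsClosedWalk d ∧
    (∀ a : A, {i | (d i).1 = a}.ncard = 2) ∧
    (∀ i, d (i + 1) ≠ Q.reverse (d i)) ∧
    S.Traverses d

end ClosedPath

end Network

end

noncomputable section

/-! ### Orbits of two involutions -/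

section Involutions

variable {H : Type*}

/-! Both bounds are measure estimates. For the Attacker, a 1-Lipschitz patrol covers length at most
`α` during an attack window, so a uniformly chosen point is intercepted with probability at most `α
/ μ` (`lengthMeasure_image_le`, `payoff_uniformAttack_le`).

For the Patroller, take a tour of length `2μ` that traverses every arc twice and never turns back.
Every point has two visits whose cyclic distance is at least `α`, in both directions around the tour
(`exists_visits`). Hence the shifts that meet a given attack contain two disjoint intervals of
length `α`, of total measure `2α` out of `2μ`. The separation comes from the girth: a nonempty
section of a nonreversing walk that returns to its starting node contains a circuit
(`le_walkLength_sub`).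

Such a tour is found by doubling every arc and pairing the half-edges at each node so that no two
copies of the same directed arc are paired. Absence of leaves makes such a pairing possible
(`exists_isTransition`). Choose one for which the orbit of a fixed half-edge under "other end" and
"partner" is largest. If it missed a half-edge, connectedness would give a node where it meets
another orbit, and switching two pairs there would enlarge it (`exists_switch`). So there is a
single orbit, and following it in one sense runs through each of the two copies of every arc exactly
once (`mem_iterate_orbit_iff`). -/

theorem even_ncard_of_involution [Finite H] {s : Set H} {f : H → H} (hmem : ∀ x ∈ s, f x ∈ s)
    (hinv : ∀ x ∈ s, f (f x) = x) (hne : ∀ x ∈ s, f x ≠ x) : Even s.ncard := by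
  classical
  have := Fintype.ofFinite H
  rw [Set.ncard_eq_toFinset_card', ← ZMod.natCast_eq_zero_iff_even, Finset.cast_card]
  refine Finset.sum_involution (fun x _ => f x) (fun _ _ => by decide)
    (fun x hx _ => hne x (Set.mem_toFinset.mp hx))
    (fun x hx => Set.mem_toFinset.mpr (hmem x (Set.mem_toFinset.mp hx)))
    fun x hx => hinv x (Set.mem_toFinset.mp hx)

/-- The smallest set that contains `h` and is closed under `f` and `g`. -/
def generatedOrbit (f g : H → H) (h : H) : Set H :=
  {x | ∀ D : Set H, h ∈ D → (∀ y ∈ D, f y ∈ D ∧ g y ∈ D) → x ∈ D}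

variable {f g : H → H} {h : H}

theorem mem_generatedOrbit_self : h ∈ generatedOrbit f g h := fun _ hD _ => hD

theorem left_mem_generatedOrbit {x : H} (hx : x ∈ generatedOrbit f g h) :
    f x ∈ generatedOrbit f g h := fun D h0 hD => (hD x (hx D h0 hD)).1

theorem right_mem_generatedOrbit {x : H} (hx : x ∈ generatedOrbit f g h) :
    g x ∈ generatedOrbit f g h := fun D h0 hD => (hD x (hx D h0 hD)).2

/-- If `f` and `g` are involutions without fixed points and `g'` arises from `g` by replacing the
pairs `a, b` and `c, d` by the pairs `a, c` and `b, d`, where the orbit contains the first pair and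
not the second one, then the orbit grows. -/
theorem generatedOrbit_ssubset [Finite H] {g' : H → H} (hf : ∀ x, f (f x) = x)
    (hf' : ∀ x, f x ≠ x) (hg : ∀ x, g (g x) = x) (hg' : ∀ x, g x ≠ x) {a c : H}
    (ha : a ∈ generatedOrbit f g h) (hc : c ∉ generatedOrbit f g h) (hac : g' a = c)
    (heq : ∀ x ∈ generatedOrbit f g h, x ≠ a → x ≠ g a → g' x = g x) :
    generatedOrbit f g h ⊂ generatedOrbit f g' h := by
  set C := generatedOrbit f g h
  set D := generatedOrbit f g' h
  have hcl : ∀ x ∈ D ∩ C, x ≠ a → x ≠ g a → g x ∈ D ∩ C := fun x hx h1 h2 =>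
    ⟨heq x hx.2 h1 h2 ▸ right_mem_generatedOrbit hx.1, right_mem_generatedOrbit hx.2⟩
  have hclf : ∀ x ∈ D ∩ C, f x ∈ D ∩ C := fun x hx =>
    ⟨left_mem_generatedOrbit hx.1, left_mem_generatedOrbit hx.2⟩
  -- Parity replaces tracing cycles: `f` pairs off `D ∩ C`, and `g` pairs off what remains after
  -- deleting `a` and `g a`. So `D` contains both of these or neither.
  have e1 : Even (D ∩ C).ncard :=
    even_ncard_of_involution hclf (fun x _ => hf x) fun x _ => hf' x
  have e2 : Even ((D ∩ C) \ {a, g a}).ncard := by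
    refine even_ncard_of_involution (f := g) (fun x hx => ?_) (fun x _ => hg x) fun x _ => hg' x
    obtain ⟨hx, hne⟩ := hx
    simp only [mem_insert_iff, mem_singleton_iff, not_or] at hne
    refine ⟨hcl x hx hne.1 hne.2, ?_⟩
    simp only [mem_insert_iff, mem_singleton_iff, not_or]
    exact ⟨fun he => hne.2 (by rw [← he, hg]), fun he => hne.1 (by rw [← hg x, he, hg])⟩
  have hiff : a ∈ D ↔ g a ∈ D := by
    by_contra hcon
    have hga : g a ∈ C := right_mem_generatedOrbit ha
    have : ∃ z ∈ D ∩ C, (D ∩ C) \ {a, g a} = (D ∩ C) \ {z} := by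
      by_cases h1 : a ∈ D
      · refine ⟨a, ⟨h1, ha⟩, ?_⟩
        have h2 : g a ∉ D := by tauto
        grind
      · refine ⟨g a, ⟨by tauto, hga⟩, ?_⟩
        grind
    obtain ⟨z, hz, he⟩ := this
    rw [he] at e2
    have := Set.ncard_sdiff_singleton_add_one hz
    rw [← this] at e1
    exact Nat.not_even_iff_odd.mpr e2.add_one e1
  -- If `D` missed both, `D ∩ C` would be closed under `f` and `g` and contain `h`, hence contain
  -- all of `C`, including `a`.
  have hsub : a ∈ D := by
    by_contra h1
    have h2 : g a ∉ D := fun h2 => h1 (hiff.mpr h2)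
    have := ha (D ∩ C) ⟨mem_generatedOrbit_self, mem_generatedOrbit_self⟩ fun y hy =>
      ⟨hclf y hy, hcl y hy (by rintro rfl; exact h1 hy.1) (by rintro rfl; exact h2 hy.1)⟩
    exact h1 this.1
  refine ⟨fun x hx => ?_, fun hDC => hc (hDC (hac ▸ right_mem_generatedOrbit hsub))⟩
  refine (hx (D ∩ C) ⟨mem_generatedOrbit_self, mem_generatedOrbit_self⟩ fun y hy =>
    ⟨hclf y hy, ?_⟩).1
  by_cases h1 : y = a
  · rw [h1]
    exact ⟨hiff.mp hsub, right_mem_generatedOrbit ha⟩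
  by_cases h2 : y = g a
  · rw [h2, hg]
    exact ⟨hsub, ha⟩
  · exact hcl y hy h1 h2

/-- If two involutions without fixed points have a single common orbit, then the orbit of their
composition contains exactly one of `x` and `f x`. -/
theorem mem_iterate_orbit_iff [Finite H] (hf : ∀ x, f (f x) = x) (hf' : ∀ x, f x ≠ x)
    (hg : ∀ x, g (g x) = x) (hg' : ∀ x, g x ≠ x) (huniv : generatedOrbit f g h = univ) (x : H) :
    f x ∈ range (fun k => (g ∘ f)^[k] h) ↔ x ∉ range (fun k => (g ∘ f)^[k] h) := by
  -- Cancelling one `g ∘ f` turns a coincidence at exponent `m + 2` for `y` into one at exponent `m`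
  -- for `g (f y)`. The descent ends in a fixed point of `f` (exponent 0) or of `g` (exponent 1).
  have hne : ∀ m y, f y ≠ (g ∘ f)^[m] y := by
    intro m
    induction m using Nat.strong_induction_on with
    | _ m ih =>
      intro y hy
      match m with
      | 0 => exact hf' y hy
      | 1 => exact hg' (f y) hy.symm
      | m + 2 =>
        refine ih m (by omega) ((g ∘ f) y) ?_
        rw [Function.iterate_succ_apply', Function.comp_apply (f := g)] at hy
        rw [← Function.iterate_succ_apply, Function.comp_apply, hy, hg, hf]
  have hinj : Function.Injective (g ∘ f) :=
    (Function.LeftInverse.injective hg).comp (Function.LeftInverse.injective hf)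
  have hper := Function.minimalPeriod_pos_of_mem_periodicPts (hinj.mem_periodicPts h)
  constructor
  · rintro ⟨j, hj⟩ ⟨i, hi⟩
    simp only at hi hj
    rcases le_total i j with hij | hij
    · apply hne (j - i) x
      rw [← hj, ← hi, ← Function.iterate_add_apply, Nat.sub_add_cancel hij]
    · apply hne (i - j) (f x)
      rw [hf, ← hj, ← hi, ← Function.iterate_add_apply, Nat.sub_add_cancel hij]
  · intro hx
    have hmem : x ∈ generatedOrbit f g h := huniv ▸ mem_univ x
    have := hmem {y | y ∈ range (fun k => (g ∘ f)^[k] h) ∨ f y ∈ range (fun k => (g ∘ f)^[k] h)}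
      (.inl ⟨0, rfl⟩) fun y hy => ⟨?_, ?_⟩
    · exact this.resolve_left hx
    · simp only [mem_ofPred_eq, hf]
      exact hy.symm
    · rcases hy with ⟨k, hk⟩ | ⟨k, hk⟩
      -- Here `f (g y)` is the predecessor of `y` in the orbit; one step back is the period minus
      -- one steps forward.
      · refine .inr ⟨k + (Function.minimalPeriod (g ∘ f) h - 1), ?_⟩
        apply hinj
        simp only [Function.comp_apply, hf, hg]
        rw [← hk]
        have := Function.iterate_succ_apply' (g ∘ f)
          (k + (Function.minimalPeriod (g ∘ f) h - 1)) h
        rw [Function.comp_apply] at this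
        rw [← this, show (k + (Function.minimalPeriod (g ∘ f) h - 1)).succ =
          k + Function.minimalPeriod (g ∘ f) h by omega, Function.iterate_add_apply,
          Function.iterate_minimalPeriod]
      · refine .inl ⟨k + 1, ?_⟩
        simp only [Function.iterate_succ_apply'] at hk ⊢
        rw [hk]
        simp [hf]

end Involutions

namespace Network

variable {V A : Type*}

/-! ### The metric and the measurable structure -/

theorem arcPoint_of_mem (Q : Network V A) (a : A) {t : ℝ} (h0 : 0 < t) (h1 : t < Q.length a) :
    Q.arcPoint a t = .inner a t h0 h1 := by
  simp [arcPoint, h0.not_ge, h1.not_ge]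

theorem arcPoint_zero (Q : Network V A) (a : A) : Q.arcPoint a 0 = .node (Q.src a) := by
  simp [arcPoint]

theorem arcPoint_length (Q : Network V A) (a : A) :
    Q.arcPoint a (Q.length a) = .node (Q.tgt a) := by
  simp [arcPoint, (Q.length_pos a).not_ge]

/-- The distance is an infimum over chains of segments inside arcs, so the triangle inequality along
a chain reduces everything to single arcs. This is how test functions on the network are produced.
-/
theorem lipschitzWith_of_arcPoint {X : Type*} [PseudoEMetricSpace X] (Q : Network V A)
    {f : Q.Point → X} (hf : ∀ a, LipschitzOnWith 1 (fun t => f (Q.arcPoint a t))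
      (Icc 0 (Q.length a))) : LipschitzWith 1 f := by
  intro x y
  rw [ENNReal.coe_one, one_mul]
  refine le_sInf fun r hr => ?_
  induction hr with
  | nil => simp
  | snoc hs ht _ ih =>
    exact (edist_triangle _ _ _).trans (add_le_add ih (by simpa using hf _ hs ht))

/-- The function on the network which is `φ` on the arc `a` and `0` elsewhere. -/
def arcExtend (Q : Network V A) (a : A) (φ : ℝ → ℝ) : Q.Point → ℝ
  | .node _ => 0
  | .inner b t _ _ => by
    classical exact if b = a then φ t else 0

theorem arcExtend_inner (Q : Network V A) (a : A) (φ : ℝ → ℝ) {t : ℝ} (h0 : 0 < t)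
    (h1 : t < Q.length a) : Q.arcExtend a φ (.inner a t h0 h1) = φ t := by
  simp [arcExtend]

theorem arcExtend_arcPoint (Q : Network V A) (a : A) {φ : ℝ → ℝ} (h0 : φ 0 = 0)
    (h1 : φ (Q.length a) = 0) {t : ℝ} (ht : t ∈ Icc 0 (Q.length a)) :
    Q.arcExtend a φ (Q.arcPoint a t) = φ t := by
  rcases eq_or_lt_of_le ht.1 with h | h
  · rw [← h, arcPoint_zero, h0]; rfl
  rcases eq_or_lt_of_le ht.2 with h' | h'
  · rw [h', arcPoint_length, h1]; rfl
  · rw [Q.arcPoint_of_mem a h h', arcExtend_inner]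

theorem arcExtend_arcPoint_of_ne (Q : Network V A) {a b : A} (hab : b ≠ a) (φ : ℝ → ℝ) (t : ℝ) :
    Q.arcExtend a φ (Q.arcPoint b t) = 0 := by
  unfold arcPoint
  split_ifs <;> simp [arcExtend, hab]

theorem lipschitzWith_arcExtend (Q : Network V A) (a : A) {φ : ℝ → ℝ} (hφ : LipschitzWith 1 φ)
    (h0 : φ 0 = 0) (h1 : φ (Q.length a) = 0) : LipschitzWith 1 (Q.arcExtend a φ) := by
  refine Q.lipschitzWith_of_arcPoint fun b => ?_
  by_cases hab : b = a
  · subst hab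
    intro s hs t ht
    simp only [Q.arcExtend_arcPoint b h0 h1 hs, Q.arcExtend_arcPoint b h0 h1 ht]
    exact hφ s t
  · simp only [Q.arcExtend_arcPoint_of_ne hab]
    exact (LipschitzWith.const (0 : ℝ)).weaken zero_le_one |>.lipschitzOnWith

/-- A tent function centred at the inner point and supported in its arc is 1-Lipschitz and attains
its maximum only there. -/
theorem eq_of_edist_inner (Q : Network V A) {a : A} {t : ℝ} {h0 : 0 < t} {h1 : t < Q.length a}
    {y : Q.Point} (h : edist (.inner a t h0 h1) y = 0) : y = .inner a t h0 h1 := by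
  set δ := min t (Q.length a - t) with hδ
  have hδ0 : 0 < δ := lt_min h0 (by linarith)
  have hδt : δ ≤ t := min_le_left _ _
  have hδl : δ ≤ Q.length a - t := min_le_right _ _
  set φ : ℝ → ℝ := fun u => max 0 (δ - dist u t) with hφ
  have hl : LipschitzWith 1 φ := by
    refine LipschitzWith.const_max ?_ 0
    refine LipschitzWith.of_dist_le_mul fun x y => ?_
    rw [Real.dist_eq, NNReal.coe_one, one_mul, sub_sub_sub_cancel_left, abs_sub_comm]
    exact abs_dist_sub_le x y t
  have hφ0 : φ 0 = 0 := by
    simp only [hφ, Real.dist_eq, zero_sub, abs_neg, abs_of_pos h0]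
    exact max_eq_left (by linarith)
  have hφ1 : φ (Q.length a) = 0 := by
    simp only [hφ, Real.dist_eq, abs_of_pos (sub_pos.mpr h1)]
    exact max_eq_left (by linarith)
  have hL := Q.lipschitzWith_arcExtend a hl hφ0 hφ1 (.inner a t h0 h1) y
  rw [h, mul_zero, nonpos_iff_eq_zero, edist_eq_zero, arcExtend_inner] at hL
  have hφt : φ t = δ := by simp [hφ, hδ0.le]
  rw [hφt] at hL
  cases y with
  | node v => exact absurd hL hδ0.ne'
  | inner b u hu0 hu1 =>
    by_cases hab : b = a
    · subst hab
      rw [arcExtend_inner] at hL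
      have : u = t := by
        by_contra hne
        have := dist_pos.mpr hne
        have : φ u < δ := max_lt hδ0 (by linarith)
        linarith
      subst this
      rfl
    · simp [arcExtend, hab] at hL
      exact absurd hL hδ0.ne'

/-- The function on the network that interpolates linearly between given values at the nodes. -/
def interpolate (Q : Network V A) (f : V → ℝ) : Q.Point → ℝ
  | .node v => f v
  | .inner a t _ _ => f (Q.src a) + t * ((f (Q.tgt a) - f (Q.src a)) / Q.length a)

theorem interpolate_arcPoint (Q : Network V A) (f : V → ℝ) (a : A) {t : ℝ}
    (ht : t ∈ Icc 0 (Q.length a)) : Q.interpolate f (Q.arcPoint a t) =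
      f (Q.src a) + t * ((f (Q.tgt a) - f (Q.src a)) / Q.length a) := by
  rcases eq_or_lt_of_le ht.1 with h | h
  · rw [← h, arcPoint_zero]; simp [interpolate]
  rcases eq_or_lt_of_le ht.2 with h' | h'
  · rw [h', arcPoint_length, mul_div_cancel₀ _ (Q.length_pos a).ne']; simp [interpolate]
  · rw [Q.arcPoint_of_mem a h h']; rfl

/-- The test function has height `c` at `v`, height 0 at the other nodes, and is linear on arcs.
Finiteness of `A` supplies a positive `c` below all arc lengths, which keeps the slopes at most 1.
-/
theorem eq_of_edist_node [Finite A] (Q : Network V A) {v w : V}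
    (h : edist (.node v : Q.Point) (.node w) = 0) : v = w := by
  classical
  obtain ⟨c, hc, hcl⟩ : ∃ c > 0, ∀ a, c ≤ Q.length a := by
    rcases isEmpty_or_nonempty A with hA | hA
    · exact ⟨1, one_pos, fun a => hA.elim a⟩
    · obtain ⟨a, ha⟩ := Finite.exists_min Q.length
      exact ⟨_, Q.length_pos a, ha⟩
  set f : V → ℝ := fun u => if u = v then c else 0 with hf
  have hff : ∀ u u', |f u - f u'| ≤ c := by
    intro u u'
    simp only [hf]
    split_ifs <;> simp [abs_of_pos hc, hc.le]
  have hL : LipschitzWith 1 (Q.interpolate f) := by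
    refine Q.lipschitzWith_of_arcPoint fun a => ?_
    refine LipschitzOnWith.of_dist_le_mul fun s hs t ht => ?_
    have hl := Q.length_pos a
    rw [Q.interpolate_arcPoint f a hs, Q.interpolate_arcPoint f a ht, Real.dist_eq, Real.dist_eq,
      add_sub_add_left_eq_sub, ← sub_mul, abs_mul, NNReal.coe_one, one_mul, abs_div,
      abs_of_pos hl]
    refine mul_le_of_le_one_right (abs_nonneg _) ?_
    rw [div_le_one hl]
    exact (hff _ _).trans (hcl a)
  have := hL (.node v) (.node w)
  rw [h, mul_zero, nonpos_iff_eq_zero, edist_eq_zero] at this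
  by_contra hne
  simp [interpolate, hf, Ne.symm hne, hc.ne'] at this

theorem eq_of_edist_eq_zero [Finite A] (Q : Network V A) {x y : Q.Point} (h : edist x y = 0) :
    x = y := by
  cases x with
  | inner => exact (Q.eq_of_edist_inner h).symm
  | node v =>
    cases y with
    | inner => exact Q.eq_of_edist_inner (by rwa [edist_comm])
    | node w => rw [Q.eq_of_edist_node h]

instance [Finite A] (Q : Network V A) : T2Space Q.Point :=
  have : T0Space Q.Point := ⟨fun _ _ h => Q.eq_of_edist_eq_zero (EMetric.inseparable_iff.mp h)⟩
  inferInstance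

theorem secondCountableTopology_point [Finite V] [Finite A] (Q : Network V A) :
    SecondCountableTopology Q.Point := by
  have h : TopologicalSpace.IsSeparable (univ : Set Q.Point) := by
    have : (univ : Set Q.Point) = range Point.node ∪ ⋃ a, range (Q.arcPoint a) := by
      refine (eq_univ_of_forall fun x => ?_).symm
      cases x with
      | node v => exact .inl ⟨v, rfl⟩
      | inner a t h0 h1 => exact .inr (mem_iUnion.mpr ⟨a, t, Q.arcPoint_of_mem a h0 h1⟩)
    rw [this]
    exact (finite_range _).countable.isSeparable.union (.iUnion fun a =>
      TopologicalSpace.isSeparable_range (Q.lipschitzWith_arcPoint a).continuous)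
  have := TopologicalSpace.isSeparable_univ_iff.mp h
  exact UniformSpace.secondCountable_of_separable _

/-! ### Measurability of the interception event -/

theorem measurableSet_intercepts [Finite V] [Finite A] (Q : Network V A) {α : ℝ} (hα : 0 < α) :
    MeasurableSet {p : Q.Patrol × Q.Attack | Q.Intercepts α p.1 p.2} := by
  have := Q.secondCountableTopology_point
  lift α to ℝ≥0 using hα.le
  have hcont : ∀ S : Q.Patrol, Continuous S.1 := fun S => S.2.continuous
  have hev : Measurable fun q : Q.Patrol × ℝ≥0 => q.1.1 q.2 := by
    have h : Measurable (Function.uncurry fun (t : ℝ≥0) (S : Q.Patrol) => S.1 t) :=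
      measurable_uncurry_of_continuous_of_measurable (fun S => hcont S)
        (fun t => (measurable_pi_apply t).comp measurable_subtype_coe)
    exact h.comp measurable_swap
  -- By compactness of the attack window, hitting `x` means that the infimum of the distance to `x`
  -- is 0. By continuity a countable dense set of times suffices; `min 1` clamps the dense sequence
  -- to the rescaled window.
  have hset : {p : Q.Patrol × Q.Attack | Q.Intercepts α p.1 p.2} =
      {p | ⨅ n : ℕ, edist (p.1.1 (p.2.2 + α * min 1 (TopologicalSpace.denseSeq ℝ≥0 n))) p.2.1
        = 0} := by
    ext ⟨S, x, τ⟩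
    have hf : Continuous fun u : ℝ≥0 => edist (S.1 (τ + α * u)) x :=
      ((hcont S).comp (by fun_prop)).edist continuous_const
    simp only [mem_ofPred_eq, Intercepts]
    constructor
    · rintro ⟨t, ht, rfl⟩
      rw [← NNReal.coe_add, mem_Icc, NNReal.coe_le_coe, NNReal.coe_le_coe] at ht
      have hα' : α ≠ 0 := by rintro rfl; simp at hα
      have hu : (t - τ) / α ≤ 1 := div_le_one_of_le₀ (tsub_le_iff_left.mpr ht.2) zero_le
      have htu : τ + α * ((t - τ) / α) = t := by
        rw [mul_div_cancel₀ _ hα', add_tsub_cancel_of_le ht.1]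
      refine le_antisymm (le_of_forall_gt fun ε hε => ?_) bot_le
      have hf' := hf.comp (continuous_const.min continuous_id : Continuous fun u : ℝ≥0 => min 1 u)
      obtain ⟨n, hn⟩ := (TopologicalSpace.denseRange_denseSeq ℝ≥0).exists_mem_open
        (isOpen_Iio.preimage hf' : IsOpen ((fun u => edist (S.1 (τ + α * min 1 u)) (S.1 t)) ⁻¹'
          Iio ε)) ⟨(t - τ) / α, by simpa [min_eq_right hu, htu] using hε⟩
      exact (iInf_le _ n).trans_lt hn
    · intro h
      obtain ⟨u, hu, hmin⟩ := (isCompact_Icc (a := (0 : ℝ≥0)) (b := 1)).exists_isMinOn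
        ⟨0, by simp⟩ hf.continuousOn
      refine ⟨τ + α * u, ⟨?_, ?_⟩, Q.eq_of_edist_eq_zero ?_⟩
      · exact_mod_cast le_self_add
      · exact_mod_cast add_le_add_right (mul_le_of_le_one_right' hu.2) τ
      · refine le_antisymm ?_ bot_le
        rw [← h]
        exact le_iInf fun n => hmin ⟨zero_le, min_le_left _ _⟩
  rw [hset]
  have hm (n : ℕ) : Measurable fun p : Q.Patrol × Q.Attack =>
      edist (p.1.1 (p.2.2 + α * min 1 (TopologicalSpace.denseSeq ℝ≥0 n))) p.2.1 := by
    have h1 : Measurable fun p : Q.Patrol × Q.Attack =>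
        (p.1, p.2.2 + α * min 1 (TopologicalSpace.denseSeq ℝ≥0 n)) := by fun_prop
    have h2 : Measurable fun p : Q.Patrol × Q.Attack => p.2.1 := by fun_prop
    exact (hev.comp h1).edist h2
  exact Measurable.iInf hm (measurableSet_singleton 0)

/-! ### The length of a Lipschitz curve -/

/-- The open half of the arc `d.1` next to the node `Q.tail d`. -/
def halfArc (Q : Network V A) (d : Q.Dart) : Set Q.Point :=
  {x | ∃ t h0 h1, x = .inner d.1 t h0 h1 ∧
    if d.2 then t < Q.length d.1 / 2 else Q.length d.1 / 2 < t}

theorem lipschitzWith_const_sub (c : ℝ) : LipschitzWith 1 fun t : ℝ => c - t :=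
  LipschitzWith.of_dist_le_mul fun x y => by rw [dist_sub_left, NNReal.coe_one, one_mul]

theorem isOpen_halfArc (Q : Network V A) (d : Q.Dart) : IsOpen (Q.halfArc d) := by
  obtain ⟨a, b⟩ := d
  set l := Q.length a with hl
  have hp : 0 < l := Q.length_pos a
  obtain ⟨φ, hφ, h0, h1, hpos⟩ : ∃ φ : ℝ → ℝ, LipschitzWith 1 φ ∧ φ 0 = 0 ∧ φ l = 0 ∧
      ∀ t, 0 < t → t < l → (0 < φ t ↔ if b then t < l / 2 else l / 2 < t) := by
    have hsub' (c : ℝ) : LipschitzWith 1 fun t : ℝ => t - c :=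
      LipschitzWith.of_dist_le_mul fun x y => by simp [Real.dist_eq]
    cases b with
    | true =>
      refine ⟨fun t => max 0 (min t (l / 2 - t)), ?_, ?_, ?_, fun t ht0 ht1 => ?_⟩
      · simpa using (LipschitzWith.id.min (lipschitzWith_const_sub (l / 2))).const_max 0
      · simp
      · exact max_eq_left (min_le_of_right_le (by linarith))
      · simp [ht0]
    | false =>
      refine ⟨fun t => max 0 (min (l - t) (t - l / 2)), ?_, ?_, ?_, fun t ht0 ht1 => ?_⟩
      · simpa using ((lipschitzWith_const_sub l).min (hsub' (l / 2))).const_max 0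
      · exact max_eq_left (min_le_of_right_le (by linarith))
      · simp [hp.le]
      · simp [ht1]
  have : Q.halfArc (a, b) = Q.arcExtend a φ ⁻¹' Ioi 0 := by
    ext x
    cases x with
    | node v => simp [halfArc, arcExtend]
    | inner c t ht0 ht1 =>
      by_cases hc : c = a
      · subst hc
        rw [mem_preimage, arcExtend_inner, mem_Ioi, hpos t ht0 ht1]
        simp only [halfArc, mem_ofPred_eq]
        constructor
        · rintro ⟨t', _, _, he, h⟩
          cases he
          exact h
        · exact fun h => ⟨t, ht0, ht1, rfl, h⟩
      · simp [halfArc, arcExtend, hc]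
  rw [this]
  exact isOpen_Ioi.preimage (Q.lipschitzWith_arcExtend a hφ h0 h1).continuous

theorem disjoint_halfArc (Q : Network V A) {d e : Q.Dart} (h : d ≠ e) :
    Disjoint (Q.halfArc d) (Q.halfArc e) := by
  rw [Set.disjoint_left]
  rintro x ⟨t, _, _, rfl, ht⟩ ⟨t', _, _, he, ht'⟩
  obtain ⟨a, b⟩ := d
  obtain ⟨a', b'⟩ := e
  cases he
  cases b <;> cases b' <;> simp at ht ht' h <;> linarith

theorem volume_image_le {f : ℝ → ℝ} {s : Set ℝ} (hf : LipschitzOnWith 1 f s) :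
    volume (f '' s) ≤ volume s := by
  simpa [hausdorffMeasure_real] using hf.hausdorffMeasure_image_le (d := 1) zero_le_one

/-- The set of points visited by a `1`-Lipschitz curve in a set of times is no longer than that
set. -/
theorem lengthMeasure_image_le [Fintype A] (Q : Network V A) {f : ℝ → Q.Point}
    (hf : LipschitzWith 1 f) {I : Set ℝ} (hI : MeasurableSet (f '' I)) :
    Q.lengthMeasure (f '' I) ≤ volume I := by
  have key (a : A) : (volume.restrict (Ioo 0 (Q.length a))).map (Q.arcPoint a) (f '' I) ≤
      ∑ b : Bool, volume.restrict I (f ⁻¹' Q.halfArc (a, b)) := by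
    have hp := Q.length_pos a
    rw [Measure.map_apply (Q.lipschitzWith_arcPoint a).continuous.measurable hI,
      Measure.restrict_apply ((Q.lipschitzWith_arcPoint a).continuous.measurable hI)]
    -- The arc coordinate itself need not extend to a 1-Lipschitz function, since its ends may be
    -- joined by a shortcut. The distance to the nearer end vanishes at both ends, so it extends by
    -- 0, and it determines the coordinate on each half of the arc. The disjoint half-arcs then use
    -- up disjoint sets of times; the midpoint is null.
    set φ : ℝ → ℝ := fun t => min t (Q.length a - t) with hφ
    have hφl : LipschitzWith 1 φ := by
      simpa using LipschitzWith.id.min (lipschitzWith_const_sub (Q.length a))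
    have hg : LipschitzWith 1 (Q.arcExtend a φ ∘ f) := by
      simpa using (Q.lipschitzWith_arcExtend a hφl (by simp [hφ, hp.le])
        (by simp [hφ, hp.le])).comp hf
    have hg' : LipschitzWith 1 fun u => Q.length a - (Q.arcExtend a φ ∘ f) u := by
      simpa using! (lipschitzWith_const_sub (Q.length a)).comp hg
    have hsub : Q.arcPoint a ⁻¹' (f '' I) ∩ Ioo 0 (Q.length a) ⊆
        (((Q.arcExtend a φ ∘ f) '' (f ⁻¹' Q.halfArc (a, true) ∩ I)) ∪
        ((fun u => Q.length a - (Q.arcExtend a φ ∘ f) u) '' (f ⁻¹' Q.halfArc (a, false) ∩ I))) ∪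
        {Q.length a / 2} := by
      rintro t ⟨⟨u, hu, hut⟩, h0, h1⟩
      rw [Q.arcPoint_of_mem a h0 h1] at hut
      rcases lt_trichotomy t (Q.length a / 2) with h | h | h
      · refine .inl (.inl ⟨u, ⟨⟨t, h0, h1, hut, by simpa using h⟩, hu⟩, ?_⟩)
        simp only [Function.comp, hut, arcExtend_inner, hφ]
        exact min_eq_left (by linarith)
      · exact .inr h
      · refine .inl (.inr ⟨u, ⟨⟨t, h0, h1, hut, by simpa using h⟩, hu⟩, ?_⟩)
        simp only [Function.comp, hut, arcExtend_inner, hφ]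
        rw [min_eq_right (by linarith)]
        ring
    refine (measure_mono hsub).trans ((measure_union_le _ _).trans ?_)
    rw [Real.volume_singleton, add_zero]
    refine (measure_union_le _ _).trans ?_
    rw [Fintype.sum_bool,
      Measure.restrict_apply (hf.continuous.measurable (Q.isOpen_halfArc _).measurableSet),
      Measure.restrict_apply (hf.continuous.measurable (Q.isOpen_halfArc _).measurableSet)]
    exact add_le_add (volume_image_le hg.lipschitzOnWith) (volume_image_le hg'.lipschitzOnWith)
  rw [lengthMeasure, Measure.finsetSum_apply]
  refine (Finset.sum_le_sum fun a _ => key a).trans ?_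
  rw [← Fintype.sum_prod_type' (f := fun a b => volume.restrict I (f ⁻¹' Q.halfArc (a, b)))]
  refine (sum_measure_le_measure_univ (s := Finset.univ)
    (t := fun d : A × Bool => f ⁻¹' Q.halfArc d) (fun d _ => ?_) fun d _ e _ h => ?_).trans_eq ?_
  · exact (hf.continuous.measurable (Q.isOpen_halfArc _).measurableSet).nullMeasurableSet
  · exact ((Q.disjoint_halfArc h).preimage f).aedisjoint
  · simp

/-! ### The Attacker's guarantee -/

theorem payoff_uniformAttack_le [Finite V] [Fintype A] [Nonempty A] (Q : Network V A) {α : ℝ}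
    (hα : 0 < α) (M : ℝ≥0) (σ : ProbabilityMeasure Q.Patrol) :
    Q.payoff α σ (Q.uniformAttack M) ≤ ENNReal.ofReal (α / Q.totalLength) := by
  have : IsFiniteMeasure Q.lengthMeasure := ⟨by simp [Q.lengthMeasure_univ]⟩
  have hm := Q.measurableSet_intercepts hα
  have hslice (S : Q.Patrol) : MeasurableSet {x | Q.Intercepts α S (x, M)} :=
    hm.preimage (by fun_prop : Measurable fun x : Q.Point => (S, ((x, M) : Q.Attack)))
  rw [payoff, Measure.prod_apply hm]
  refine (lintegral_mono (g := fun _ => ENNReal.ofReal (α / Q.totalLength)) fun S => ?_).trans_eq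
    (by simp)
  have hmS : MeasurableSet (Prod.mk S ⁻¹' {p : Q.Patrol × Q.Attack | Q.Intercepts α p.1 p.2}) :=
    hm.preimage measurable_prodMk_left
  simp only [uniformAttack, ProbabilityMeasure.coe_mk]
  rw [Measure.prod_dirac, Measure.map_apply (by fun_prop) hmS, Measure.smul_apply, smul_eq_mul,
    ENNReal.ofReal_div_of_pos Q.totalLength_pos, ENNReal.div_eq_inv_mul]
  gcongr
  -- The patrol is extended to negative times by its initial position, so that the estimate for
  -- curves on the whole line applies.
  have hf : LipschitzWith 1 fun t : ℝ => S.1 t.toNNReal := by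
    simpa using! S.2.comp Real.lipschitzWith_toNNReal
  have himage : {x | Q.Intercepts α S (x, M)} =
      (fun t : ℝ => S.1 t.toNNReal) '' Icc (M : ℝ) (M + α) := by
    ext x
    constructor
    · rintro ⟨t, ht, rfl⟩
      exact ⟨t, ht, by simp⟩
    · rintro ⟨t, ht, rfl⟩
      exact ⟨t.toNNReal, by rwa [Real.coe_toNNReal t (M.2.trans ht.1)], rfl⟩
  have := Q.lengthMeasure_image_le hf (himage ▸ hslice S)
  rw [← himage, Real.volume_Icc, add_sub_cancel_left] at this
  exact this

/-! ### Closed walks without reversals -/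

/-- The length of the first `k` directed arcs of a walk. -/
def walkLength (Q : Network V A) (D : ℕ → Q.Dart) (k : ℕ) : ℝ :=
  ∑ j ∈ Finset.range k, Q.length (D j).1

theorem walkLength_succ (Q : Network V A) (D : ℕ → Q.Dart) (k : ℕ) :
    Q.walkLength D (k + 1) = Q.walkLength D k + Q.length (D k).1 :=
  Finset.sum_range_succ _ _

theorem monotone_walkLength (Q : Network V A) (D : ℕ → Q.Dart) : Monotone (Q.walkLength D) :=
  monotone_nat_of_le_succ fun k => by
    rw [walkLength_succ]
    linarith [Q.length_pos (D k).1]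

theorem tail_reverse (Q : Network V A) (d : Q.Dart) : Q.tail (Q.reverse d) = Q.head d := by
  obtain ⟨a, b⟩ := d
  cases b <;> rfl

theorem head_reverse (Q : Network V A) (d : Q.Dart) : Q.head (Q.reverse d) = Q.tail d := by
  obtain ⟨a, b⟩ := d
  cases b <;> rfl

theorem eq_or_eq_reverse (Q : Network V A) {d e : Q.Dart} (h : d.1 = e.1) :
    e = d ∨ e = Q.reverse d := by
  obtain ⟨a, b⟩ := d
  obtain ⟨a', b'⟩ := e
  cases h
  cases b <;> cases b' <;> simp [reverse]

/-- If the arcs of the closed section are distinct, it is a circuit and the girth bounds its length.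
Otherwise a repeated arc cuts out a strictly shorter closed section, and the induction is on the
number of arcs. -/
theorem le_walkLength_sub (Q : Network V A) {α : ℝ} (hg : ENNReal.ofReal α ≤ Q.girth)
    {D : ℕ → Q.Dart} (hD : ∀ k, Q.head (D k) = Q.tail (D (k + 1)))
    (hrev : ∀ k, D (k + 1) ≠ Q.reverse (D k)) {p q : ℕ} (hpq : p < q)
    (h : Q.tail (D p) = Q.tail (D q)) : α ≤ Q.walkLength D q - Q.walkLength D p := by
  induction hm : q - p using Nat.strong_induction_on generalizing p q with
  | _ m ih =>
    have hmono := Q.monotone_walkLength D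
    by_cases hinj : ∀ r s, p ≤ r → r < s → s < q → (D r).1 ≠ (D s).1
    · obtain ⟨n, rfl⟩ : ∃ n, q = p + (n + 1) := ⟨q - p - 1, by omega⟩
      have hcirc : Q.IsCircuit (fun i : Fin (n + 1) => D (p + i)) := by
        constructor
        · intro i
          rcases eq_or_ne i (Fin.last n) with rfl | hi
          · simp only [Fin.val_last, Fin.last_add_one, Fin.val_zero, add_zero]
            rw [hD, h, add_assoc]
          · have : ((i + 1 : Fin (n + 1)) : ℕ) = i + 1 :=
              Fin.val_add_one_of_lt (Fin.lt_last_iff_ne_last.mpr hi)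
            simp only [this]
            exact hD _
        · intro i j hij
          by_contra hne
          rcases lt_or_gt_of_ne (Fin.val_injective.ne hne) with hlt | hlt
          · exact hinj (p + i) (p + j) (by omega) (by omega) (by omega) hij
          · exact hinj (p + j) (p + i) (by omega) (by omega) (by omega) hij.symm
      have h1 : Q.girth ≤ ENNReal.ofReal (∑ i : Fin (n + 1), Q.length (D (p + i)).1) :=
        iInf_le_of_le n (iInf_le_of_le _ (iInf_le _ hcirc))
      have h2 := (ENNReal.ofReal_le_ofReal_iff
        (Finset.sum_nonneg fun i _ => (Q.length_pos _).le)).mp (hg.trans h1)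
      rw [Fin.sum_univ_eq_sum_range (fun i => Q.length (D (p + i)).1)] at h2
      rw [walkLength, walkLength, Finset.sum_range_add]
      linarith
    · push Not at hinj
      obtain ⟨r, s, hpr, hrs, hsq, hA⟩ := hinj
      have hs := hmono hsq.le
      rcases Q.eq_or_eq_reverse hA with he | he
      · have := ih (s - r) (by omega) hrs (by rw [he]) rfl
        have := hmono hpr
        linarith
      -- For an arc repeated in the opposite direction, the closed section lies strictly between the
      -- two traversals. It is nonempty because the walk does not reverse.
      · have hne : r + 1 ≠ s := by
          rintro rfl
          exact hrev r he
        have := ih (s - (r + 1)) (by omega) (p := r + 1) (q := s) (by omega)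
          (by rw [he, tail_reverse, hD]) rfl
        have := hmono (by omega : p ≤ r + 1)
        linarith

theorem exists_tail_eq [Nonempty A] (Q : Network V A) (v : V) : ∃ d : Q.Dart, Q.tail d = v := by
  obtain ⟨a⟩ := ‹Nonempty A›
  induction Q.connected (Q.src a) v with
  | refl => exact ⟨(a, true), rfl⟩
  | tail _ h _ =>
    obtain ⟨b, ⟨-, h⟩ | ⟨h, -⟩⟩ := h
    · exact ⟨(b, false), h⟩
    · exact ⟨(b, true), h⟩

theorem dartPoint_zero (Q : Network V A) (d : Q.Dart) : Q.dartPoint d 0 = .node (Q.tail d) := by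
  obtain ⟨a, b⟩ := d
  cases b <;> simp [dartPoint, tail, arcPoint_zero, arcPoint_length]

theorem dartPoint_length (Q : Network V A) (d : Q.Dart) :
    Q.dartPoint d (Q.length d.1) = .node (Q.head d) := by
  obtain ⟨a, b⟩ := d
  cases b <;> simp [dartPoint, head, arcPoint_zero, arcPoint_length]

theorem dartPoint_reverse (Q : Network V A) (d : Q.Dart) (s : ℝ) :
    Q.dartPoint (Q.reverse d) (Q.length d.1 - s) = Q.dartPoint d s := by
  obtain ⟨a, b⟩ := d
  cases b <;> simp [dartPoint, reverse]

theorem exists_dartPoint_eq (Q : Network V A) (d : Q.Dart) {a : A} (h : d.1 = a) {t : ℝ}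
    (ht : t ∈ Icc 0 (Q.length a)) :
    ∃ s ∈ Icc 0 (Q.length d.1), Q.dartPoint d s = Q.arcPoint a t := by
  subst h
  obtain ⟨a, b⟩ := d
  cases b
  · exact ⟨Q.length a - t, ⟨by linarith [ht.2], by linarith [ht.1]⟩, by simp [dartPoint]⟩
  · exact ⟨t, ht, by simp [dartPoint]⟩

/-- The infinite walk that repeats a cyclic sequence of directed arcs. -/
def unroll (Q : Network V A) {n : ℕ} (d : Fin (n + 1) → Q.Dart) (k : ℕ) : Q.Dart :=
  d (Fin.ofNat (n + 1) k)

theorem unroll_val (Q : Network V A) {n : ℕ} (d : Fin (n + 1) → Q.Dart) (i : Fin (n + 1)) :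
    Q.unroll d i = d i := by
  simp [unroll]

theorem unroll_succ (Q : Network V A) {n : ℕ} (d : Fin (n + 1) → Q.Dart) (k : ℕ) :
    Q.unroll d (k + 1) = d (Fin.ofNat (n + 1) k + 1) := by
  unfold unroll
  congr 1
  ext
  simp [Fin.val_add]

theorem unroll_add (Q : Network V A) {n : ℕ} (d : Fin (n + 1) → Q.Dart) (k : ℕ) :
    Q.unroll d (k + (n + 1)) = Q.unroll d k := by
  unfold unroll
  congr 1
  ext
  simp

theorem IsClosedWalk.head_unroll {Q : Network V A} {n : ℕ} {d : Fin (n + 1) → Q.Dart}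
    (h : Q.IsClosedWalk d) (k : ℕ) : Q.head (Q.unroll d k) = Q.tail (Q.unroll d (k + 1)) := by
  rw [unroll_succ]
  exact h _

theorem walkLength_unroll_eq_sum (Q : Network V A) {n : ℕ} (d : Fin (n + 1) → Q.Dart) :
    Q.walkLength (Q.unroll d) (n + 1) = ∑ i, Q.length (d i).1 := by
  rw [walkLength, ← Fin.sum_univ_eq_sum_range (fun j => Q.length (Q.unroll d j).1)]
  simp only [unroll_val]

theorem walkLength_unroll_val (Q : Network V A) {n : ℕ} (d : Fin (n + 1) → Q.Dart)
    (i : Fin (n + 1)) :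
    Q.walkLength (Q.unroll d) i = ∑ j ∈ Finset.Iio i, Q.length (d j).1 := by
  rw [walkLength, ← Nat.Iio_eq_range, ← Fin.map_valEmbedding_Iio, Finset.sum_map]
  simp [unroll_val]

theorem walkLength_unroll_add (Q : Network V A) {n : ℕ} (d : Fin (n + 1) → Q.Dart) (k : ℕ) :
    Q.walkLength (Q.unroll d) (k + (n + 1)) =
      Q.walkLength (Q.unroll d) k + ∑ i, Q.length (d i).1 := by
  rw [← walkLength_unroll_eq_sum, add_comm k, walkLength, Finset.sum_range_add,
    add_comm (Q.walkLength _ k)]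
  congr 1
  refine Finset.sum_congr rfl fun j _ => ?_
  rw [add_comm (n + 1), unroll_add]

/-! ### The periodic tour -/

namespace ClosedPath

variable {Q : Network V A}

theorem periodic_add (S : ClosedPath Q) (t : ℝ) : S.periodic (t + S.L) = S.periodic t := by
  simp [periodic]

/-- A nonreversing double cover, unrolled to an infinite walk. -/
theorem IsNonreversingDoubleCover.exists_walk {S : ClosedPath Q}
    (h : S.IsNonreversingDoubleCover) : ∃ (N : ℕ) (D : ℕ → Q.Dart) (c : ℝ),
      (∀ k, Q.head (D k) = Q.tail (D (k + 1))) ∧ (∀ k, D (k + 1) ≠ Q.reverse (D k)) ∧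
      (∀ k, D (k + N) = D k) ∧ (∀ k, Q.walkLength D (k + N) = Q.walkLength D k + S.L) ∧
      (∀ k, ∀ s ∈ Icc 0 (Q.length (D k).1),
        S.periodic (c + Q.walkLength D k + s) = Q.dartPoint (D k) s) ∧
      ∀ a, ∃ i j, i < j ∧ j < i + N ∧ (D i).1 = a ∧ (D j).1 = a := by
  obtain ⟨n, d, hd, h2, hrev, hL, c, hc⟩ := h
  refine ⟨n + 1, Q.unroll d, c, hd.head_unroll, fun k => ?_, Q.unroll_add d, fun k => ?_,
    fun k => ?_, fun a => ?_⟩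
  · rw [unroll_succ]
    exact hrev _
  · rw [hL, walkLength_unroll_add]
  · induction k using Nat.strong_induction_on with
    | _ k ih =>
      intro s hs
      rcases lt_or_ge k (n + 1) with hk | hk
      · lift k to Fin (n + 1) using hk
        rw [unroll_val] at hs ⊢
        rw [walkLength_unroll_val]
        exact hc k s hs
      · obtain ⟨m, rfl⟩ := Nat.exists_eq_add_of_le' hk
        have := ih m (by omega) s (by rwa [← unroll_add])
        rw [unroll_add, ← this, walkLength_unroll_add, ← hL,
          ← S.periodic_add (c + Q.walkLength (Q.unroll d) m + s)]
        congr 1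
        ring
  · obtain ⟨i, j, hij, he⟩ := Set.ncard_eq_two.mp (h2 a)
    have hi : (d i).1 = a := by
      have : i ∈ {i | (d i).1 = a} := he ▸ mem_insert _ _
      exact this
    have hj : (d j).1 = a := by
      have : j ∈ {i | (d i).1 = a} := he ▸ mem_insert_of_mem _ rfl
      exact this
    rcases lt_or_gt_of_ne (Fin.val_injective.ne hij) with hlt | hlt
    · exact ⟨i, j, hlt, by omega, by rwa [unroll_val], by rwa [unroll_val]⟩
    · exact ⟨j, i, hlt, by omega, by rwa [unroll_val], by rwa [unroll_val]⟩

/-- Every point is visited twice, at times whose cyclic distance is at least `α`. -/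
theorem IsNonreversingDoubleCover.exists_visits [Nonempty A] {S : ClosedPath Q}
    (h : S.IsNonreversingDoubleCover) {α : ℝ} (hg : ENNReal.ofReal α ≤ Q.girth) (x : Q.Point) :
    ∃ t₁ t₂, S.periodic t₁ = x ∧ S.periodic t₂ = x ∧ t₁ + α ≤ t₂ ∧ t₂ + α ≤ t₁ + S.L := by
  obtain ⟨N, D, c, hD, hrev, hper, hw, hS, htwo⟩ := h.exists_walk
  have key {p q : ℕ} (hpq : p < q) (he : Q.tail (D p) = Q.tail (D q)) :=
    Q.le_walkLength_sub hg hD hrev hpq he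
  have hstart (k : ℕ) : S.periodic (c + Q.walkLength D k) = .node (Q.tail (D k)) := by
    have := hS k 0 ⟨le_rfl, (Q.length_pos _).le⟩
    rwa [add_zero, dartPoint_zero] at this
  have hnode {v : V} {p q : ℕ} (hpq : p < q) (hq : q < p + N) (hp : Q.tail (D p) = v)
      (hq' : Q.tail (D q) = v) : ∃ t₁ t₂, S.periodic t₁ = .node v ∧ S.periodic t₂ = .node v ∧
        t₁ + α ≤ t₂ ∧ t₂ + α ≤ t₁ + S.L := by
    refine ⟨c + Q.walkLength D p, c + Q.walkLength D q, by rw [hstart, hp], by rw [hstart, hq'],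
      ?_, ?_⟩
    · linarith [key hpq (hp.trans hq'.symm)]
    · have := key hq (by rw [hper, hp, hq'])
      rw [hw] at this
      linarith
  cases x with
  | node v =>
    obtain ⟨e, rfl⟩ := Q.exists_tail_eq v
    obtain ⟨i, j, hij, hji, hi, hj⟩ := htwo e.1
    -- A traversal of `e` leaves the node at its own index; a traversal of the reverse arrives
    -- there, so the departure has the next index. The two departures could coincide cyclically only
    -- at a forbidden reversal.
    rcases Q.eq_or_eq_reverse hi.symm with hi | hi <;>
      rcases Q.eq_or_eq_reverse hj.symm with hj | hj
    · exact hnode hij hji (by rw [hi]) (by rw [hj])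
    · have hne : j + 1 ≠ i + N := by
        intro hne
        apply hrev j
        rw [hne, hper, hi, hj]
        simp [reverse]
      exact hnode (p := i) (q := j + 1) (by omega) (by omega) (by rw [hi])
        (by rw [← hD, hj, head_reverse])
    · have hne : i + 1 ≠ j := by
        rintro rfl
        apply hrev i
        rw [hi, hj]
        simp [reverse]
      exact hnode (p := i + 1) (q := j) (by omega) (by omega) (by rw [← hD, hi, head_reverse])
        (by rw [hj])
    · exact hnode (p := i + 1) (q := j + 1) (by omega) (by omega)
        (by rw [← hD, hi, head_reverse]) (by rw [← hD, hj, head_reverse])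
  | inner a t h0 h1 =>
    obtain ⟨i, j, hij, hji, hi, hj⟩ := htwo a
    obtain ⟨s, hs, hst⟩ := Q.exists_dartPoint_eq (D i) hi ⟨h0.le, h1.le⟩
    rw [Q.arcPoint_of_mem a h0 h1] at hst
    rcases Q.eq_or_eq_reverse (hi.trans hj.symm) with he | he
    · refine ⟨c + Q.walkLength D i + s, c + Q.walkLength D j + s, by rw [hS i s hs, hst],
        by rw [hS j s (by rwa [he]), he, hst], ?_, ?_⟩
      · linarith [key hij (by rw [he])]
      · have := key hji (by rw [hper, he])
        rw [hw] at this
        linarith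
    -- With opposite directions, the time between the visits is a closed section of the walk plus
    -- twice the rest of the arc: `length - s` on each side going from `i` to `j`, and `s` on each
    -- side going around from `j` to `i + N`.
    · have hlen : Q.length (D j).1 = Q.length (D i).1 := by rw [hi, hj]
      refine ⟨c + Q.walkLength D i + s, c + Q.walkLength D j + (Q.length (D i).1 - s),
        by rw [hS i s hs, hst], ?_, ?_, ?_⟩
      · rw [hS j _ (by rw [hlen]; exact ⟨by linarith [hs.2], by linarith [hs.1]⟩), he,
          dartPoint_reverse, hst]
      · have hne : i + 1 ≠ j := by
          rintro rfl
          exact hrev i he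
        have := key (p := i + 1) (q := j) (by omega) (by rw [← hD, he, tail_reverse])
        rw [walkLength_succ] at this
        linarith [hs.2]
      · have hne : j + 1 ≠ i + N := by
          intro hne
          apply hrev j
          rw [hne, hper, he]
          simp [reverse]
        have := key (p := j + 1) (q := i + N) (by omega) (by rw [← hD, he, head_reverse, hper])
        rw [walkLength_succ, hw, hlen] at this
        linarith [hs.1]

theorem IsNonreversingDoubleCover.length_eq [Fintype A] {S : ClosedPath Q}
    (h : S.IsNonreversingDoubleCover) : S.L = 2 * Q.totalLength := by
  classical
  obtain ⟨n, d, -, h2, -, hL, -⟩ := h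
  rw [hL, totalLength, Finset.mul_sum,
    ← Finset.sum_fiberwise_of_maps_to (t := Finset.univ) (g := fun i => (d i).1)
      fun _ _ => Finset.mem_univ _]
  refine Finset.sum_congr rfl fun a _ => ?_
  rw [Finset.sum_congr rfl (g := fun _ => Q.length a)
    fun i hi => by rw [(Finset.mem_filter.mp hi).2], Finset.sum_const, nsmul_eq_mul]
  have := h2 a
  rw [Set.ncard_eq_toFinset_card', Set.toFinset_ofPred] at this
  rw [this]
  norm_num

/-- A visit at time `t₁` is caught by every shift between `t₁ - τ - α` and `t₁ - τ`, and similarly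
for `t₂`. The separation hypotheses make the two intervals disjoint within one period. -/
theorem two_mul_le_volume_visits (S : ClosedPath Q) {α : ℝ} (hα : 0 < α) {x : Q.Point} {τ : ℝ}
    (hE : MeasurableSet {Δ | ∃ t ∈ Icc τ (τ + α), S.periodic (t + Δ) = x}) {t₁ t₂ : ℝ}
    (h₁ : S.periodic t₁ = x) (h₂ : S.periodic t₂ = x) (h₁₂ : t₁ + α ≤ t₂)
    (h₂₁ : t₂ + α ≤ t₁ + S.L) :
    ENNReal.ofReal (2 * α) ≤
      volume.restrict (Icc 0 S.L) {Δ | ∃ t ∈ Icc τ (τ + α), S.periodic (t + Δ) = x} := by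
  set E := {Δ | ∃ t ∈ Icc τ (τ + α), S.periodic (t + Δ) = x} with hEdef
  have hinv (g : AddSubgroup.zmultiples S.L) : (fun y => g +ᵥ y) ⁻¹' E = E := by
    obtain ⟨_, m, rfl⟩ := g
    ext Δ
    have hp (t : ℝ) : S.periodic (t + (m • S.L + Δ)) = S.periodic (t + Δ) := by
      have := (show Function.Periodic S.periodic S.L from S.periodic_add).zsmul m (t + Δ)
      rw [← this]
      congr 1
      ring
    simp only [mem_preimage, hEdef, mem_ofPred_eq, AddSubgroup.vadd_def, vadd_eq_add, hp]
  rw [Measure.restrict_congr_set Ioc_ae_eq_Icc.symm, Measure.restrict_apply hE]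
  -- The set of good shifts is periodic, so the period may be started at `t₁ - τ - α`, where neither
  -- interval wraps around.
  have hu := (isAddFundamentalDomain_Ioc S.L_pos 0 volume).measure_set_eq
    (isAddFundamentalDomain_Ioc S.L_pos (t₁ - τ - α) volume) hE hinv
  rw [zero_add] at hu
  rw [hu]
  have hsub : Ioc (t₁ - τ - α) (t₁ - τ) ∪ Ioc (t₂ - τ - α) (t₂ - τ) ⊆
      E ∩ Ioc (t₁ - τ - α) (t₁ - τ - α + S.L) := by
    rintro Δ (⟨hl, hr⟩ | ⟨hl, hr⟩)
    · exact ⟨⟨t₁ - Δ, ⟨by linarith, by linarith⟩, by rwa [sub_add_cancel]⟩, hl, by linarith⟩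
    · exact ⟨⟨t₂ - Δ, ⟨by linarith, by linarith⟩, by rwa [sub_add_cancel]⟩, by linarith,
        by linarith⟩
  refine le_trans ?_ (measure_mono hsub)
  rw [measure_union _ measurableSet_Ioc, Real.volume_Ioc, Real.volume_Ioc,
    ← ENNReal.ofReal_add (by linarith) (by linarith)]
  · exact ENNReal.ofReal_le_ofReal (by linarith)
  · rw [Set.disjoint_left]
    rintro Δ ⟨-, h⟩ ⟨h', -⟩
    linarith

/-- The randomized extension of a nonreversing double cover intercepts every attack with
probability at least `α / μ`. -/
theorem IsNonreversingDoubleCover.le_payoff [Finite V] [Fintype A] [Nonempty A] {S : ClosedPath Q}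
    (h : S.IsNonreversingDoubleCover) {α : ℝ} (hα : 0 < α) (hg : ENNReal.ofReal α ≤ Q.girth)
    (ν : ProbabilityMeasure Q.Attack) :
    ENNReal.ofReal (α / Q.totalLength) ≤ Q.payoff α S.randomizedExtension ν := by
  have hm := Q.measurableSet_intercepts hα
  rw [payoff, Measure.prod_apply_symm hm]
  refine le_trans (by simp) (lintegral_mono (f := fun _ => ENNReal.ofReal (α / Q.totalLength))
    fun p => ?_)
  obtain ⟨x, τ⟩ := p
  have hms : MeasurableSet ((fun σ : Q.Patrol => (σ, ((x, τ) : Q.Attack))) ⁻¹'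
      {p : Q.Patrol × Q.Attack | Q.Intercepts α p.1 p.2}) := hm.preimage measurable_prodMk_right
  have hE : S.shift ⁻¹' ((fun σ : Q.Patrol => (σ, ((x, τ) : Q.Attack))) ⁻¹'
      {p : Q.Patrol × Q.Attack | Q.Intercepts α p.1 p.2}) =
      {Δ | ∃ t ∈ Icc (τ : ℝ) (τ + α), S.periodic (t + Δ) = x} := by
    ext Δ
    constructor
    · rintro ⟨t, ht, he⟩
      exact ⟨t, ht, he⟩
    · rintro ⟨t, ht, he⟩
      lift t to ℝ≥0 using τ.2.trans ht.1
      exact ⟨t, ht, he⟩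
  obtain ⟨t₁, t₂, h₁, h₂, h₁₂, h₂₁⟩ := h.exists_visits hg x
  have hvol := S.two_mul_le_volume_visits hα (hE ▸ hms.preimage S.measurable_shift)
    h₁ h₂ h₁₂ h₂₁
  simp only [randomizedExtension, ProbabilityMeasure.coe_mk]
  rw [Measure.map_apply S.measurable_shift hms, hE, Measure.smul_apply, smul_eq_mul,
    ← ENNReal.div_eq_inv_mul]
  have : α / Q.totalLength = (2 * α) / S.L := by
    rw [h.length_eq, mul_div_mul_left _ _ two_ne_zero]
  rw [this, ENNReal.ofReal_div_of_pos S.L_pos]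
  exact ENNReal.div_le_div_right hvol _

end ClosedPath

/-! ### A nonreversing double cover -/

/-- Every arc is doubled; a half-edge is one of the two copies of a directed arc. -/
abbrev HalfEdge (Q : Network V A) : Type _ := Q.Dart × Bool

/-- The other end of a copy of an arc. -/
def opposite (Q : Network V A) (x : Q.HalfEdge) : Q.HalfEdge := (Q.reverse x.1, x.2)

theorem reverse_reverse (Q : Network V A) (d : Q.Dart) : Q.reverse (Q.reverse d) = d := by
  simp [reverse]

theorem reverse_ne (Q : Network V A) (d : Q.Dart) : Q.reverse d ≠ d := by
  intro h
  simpa [reverse] using congrArg Prod.snd h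

theorem opposite_opposite (Q : Network V A) (x : Q.HalfEdge) :
    Q.opposite (Q.opposite x) = x := by
  simp [opposite, reverse_reverse]

theorem opposite_ne (Q : Network V A) (x : Q.HalfEdge) : Q.opposite x ≠ x := fun h =>
  Q.reverse_ne x.1 (congrArg Prod.fst h)

/-- A pairing of the half-edges at each node that never pairs two copies of a directed arc. -/
structure IsTransition (Q : Network V A) (τ : Equiv.Perm Q.HalfEdge) : Prop where
  apply_apply : ∀ x, τ (τ x) = x
  tail_eq : ∀ x, Q.tail (τ x).1 = Q.tail x.1
  fst_ne : ∀ x, (τ x).1 ≠ x.1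

theorem exists_perm_forall_ne {B : Type*} [Finite B] (h : Nat.card B ≠ 1) :
    ∃ ρ : Equiv.Perm B, ∀ x, ρ x ≠ x := by
  let e := Finite.equivFin B
  refine ⟨(e.trans (finRotate _)).trans e.symm, fun x hx => ?_⟩
  have h2 : 2 ≤ Nat.card B := by
    have : 0 < Nat.card B := Nat.card_pos_iff.mpr ⟨⟨x⟩, inferInstance⟩
    omega
  have := Finset.mem_univ (e x)
  rw [← support_finRotate_of_le h2, Equiv.Perm.mem_support] at this
  apply this
  rw [← e.apply_symm_apply (finRotate _ (e x))]
  exact congrArg e hx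

/-- A set whose size is not 1 has a permutation `ρ` without fixed points; apply this to the passages
at each node. Joining the first copy of `d` to the second copy of `ρ d` is an involution even if `ρ`
is not, so no parity condition on degrees arises. -/
theorem exists_isTransition [Finite A] (Q : Network V A) (hQ : ∀ a, ¬ Q.IsLeafArc a) :
    ∃ τ, Q.IsTransition τ := by
  have hfib (v : V) : ∃ ρ : Equiv.Perm {d : Q.Dart // Q.tail d = v}, ∀ x, ρ x ≠ x := by
    refine exists_perm_forall_ne fun h1 => ?_
    obtain ⟨⟨⟨⟨a, b⟩, rfl⟩⟩, -⟩ := Nat.card_pos_iff.mp (h1.symm ▸ one_pos)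
    refine hQ a ?_
    cases b
    · exact .inr h1
    · exact .inl h1
  choose r hr using hfib
  let ρ : Equiv.Perm Q.Dart :=
    (Equiv.sigmaFiberEquiv Q.tail).permCongr (Equiv.Perm.sigmaCongrRight r)
  have hρ (d : Q.Dart) : ρ d = r (Q.tail d) ⟨d, rfl⟩ := rfl
  have htail (d : Q.Dart) : Q.tail (ρ d) = Q.tail d := by
    rw [hρ]
    exact (r (Q.tail d) ⟨d, rfl⟩).2
  have hne (d : Q.Dart) : ρ d ≠ d := fun h => hr _ ⟨d, rfl⟩ (Subtype.ext h)
  have htail' (d : Q.Dart) : Q.tail (ρ.symm d) = Q.tail d := by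
    rw [← htail, ρ.apply_symm_apply]
  have hne' (d : Q.Dart) : ρ.symm d ≠ d := fun h => hne d (by rw [← h, ρ.apply_symm_apply, h])
  let t : Q.HalfEdge → Q.HalfEdge := fun x => if x.2 then (ρ x.1, false) else (ρ.symm x.1, true)
  have ht : Function.Involutive t := by
    rintro ⟨d, b⟩
    cases b <;> simp [t]
  refine ⟨ht.toPerm, ht, ?_, ?_⟩
  · rintro ⟨d, b⟩
    cases b
    · exact htail' d
    · exact htail d
  · rintro ⟨d, b⟩
    cases b
    · exact hne' d
    · exact hne d

/-- Switching two pairs at a node. -/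
theorem IsTransition.exists_switch [Finite A] {Q : Network V A} {τ : Equiv.Perm Q.HalfEdge}
    (hτ : Q.IsTransition τ) {h a c : Q.HalfEdge} (ha : a ∈ generatedOrbit Q.opposite τ h)
    (hc : c ∉ generatedOrbit Q.opposite τ h) (htail : Q.tail a.1 = Q.tail c.1)
    (h1 : a.1 ≠ c.1) (h2 : (τ a).1 ≠ (τ c).1) :
    ∃ τ', Q.IsTransition τ' ∧
      generatedOrbit Q.opposite τ h ⊂ generatedOrbit Q.opposite τ' h := by
  classical
  have hτa : τ a ∈ generatedOrbit Q.opposite τ h := right_mem_generatedOrbit ha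
  have hτc : τ c ∉ generatedOrbit Q.opposite τ h := fun hcon =>
    hc (hτ.apply_apply c ▸ right_mem_generatedOrbit hcon)
  have hne (x) : τ x ≠ x := fun he => hτ.fst_ne x (congrArg Prod.fst he)
  have hac : a ≠ c := by rintro rfl; exact hc ha
  have hbc : τ a ≠ c := fun he => hc (he ▸ hτa)
  have hbd : τ a ≠ τ c := fun he => hac (τ.injective he)
  have had : a ≠ τ c := by rintro he; exact hτc (he ▸ ha)
  -- Conjugating `τ` by this transposition replaces the pairs `a, τ a` and `c, τ c` by `a, c` and `τ
  -- a, τ c`. The hypotheses `h1` and `h2` say precisely that the new pairs are allowed.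
  set s := Equiv.swap (τ a) c with hs
  have sa : s a = a := Equiv.swap_apply_of_ne_of_ne (hne a).symm hac
  have sd : s (τ c) = τ c := Equiv.swap_apply_of_ne_of_ne hbd.symm (hne c)
  have sb : s (τ a) = c := Equiv.swap_apply_left _ _
  have sc : s c = τ a := Equiv.swap_apply_right _ _
  have so {x} (hx : x ≠ τ a) (hx' : x ≠ c) : s x = x := Equiv.swap_apply_of_ne_of_ne hx hx'
  have ss (x) : s (s x) = x := Equiv.swap_apply_self _ _ x
  have hstail (x) : Q.tail (s x).1 = Q.tail x.1 := by
    by_cases hx : x = τ a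
    · rw [hx, sb, hτ.tail_eq, htail]
    by_cases hx' : x = c
    · rw [hx', sc, hτ.tail_eq, htail]
    · rw [so hx hx']
  have happ (x) : (s * τ * s) x = s (τ (s x)) := rfl
  have hother {x} (hxa : x ≠ a) (hxb : x ≠ τ a) (hxc : x ≠ c) (hxd : x ≠ τ c) :
      (s * τ * s) x = τ x := by
    rw [happ, so hxb hxc, so (fun he => hxa (τ.injective he))
      (fun he => hxd (by rw [← he, hτ.apply_apply]))]
  have hA : (s * τ * s) a = c := by rw [happ, sa, sb]
  refine ⟨s * τ * s, ⟨fun x => ?_, fun x => ?_, fun x => ?_⟩, ?_⟩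
  · rw [happ, happ, ss, hτ.apply_apply, ss]
  · rw [happ, hstail, hτ.tail_eq, hstail]
  · by_cases hxa : x = a
    · rw [hxa, hA]
      exact h1.symm
    by_cases hxb : x = τ a
    · rw [hxb, happ, sb, sd]
      exact h2.symm
    by_cases hxc : x = c
    · rw [hxc, happ, sc, hτ.apply_apply, sa]
      exact h1
    by_cases hxd : x = τ c
    · rw [hxd, happ, sd, hτ.apply_apply, sc]
      exact h2
    · rw [hother hxa hxb hxc hxd]
      exact hτ.fst_ne x
  · refine generatedOrbit_ssubset Q.opposite_opposite Q.opposite_ne hτ.apply_apply hne ha hc hA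
      fun x hx hxa hxb => hother hxa hxb ?_ ?_
    · rintro rfl
      exact hc hx
    · rintro rfl
      exact hτc hx

/-- A transition whose orbit is of maximal size admits no enlarging switch. This forces the orbit to
contain all half-edges at every node it meets, and connectedness carries it everywhere. -/
theorem exists_isTransition_generatedOrbit_eq_univ [Finite A] (Q : Network V A)
    (hQ : ∀ a, ¬ Q.IsLeafArc a) (h : Q.HalfEdge) :
    ∃ τ, Q.IsTransition τ ∧ generatedOrbit Q.opposite τ h = univ := by
  obtain ⟨τ₀, hτ₀⟩ := Q.exists_isTransition hQ
  obtain ⟨τ, hτ, hmax⟩ := Set.exists_max_image {τ | Q.IsTransition τ}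
    (fun τ => (generatedOrbit Q.opposite τ h).ncard) (Set.toFinite _) ⟨τ₀, hτ₀⟩
  replace hτ : Q.IsTransition τ := hτ
  refine ⟨τ, hτ, ?_⟩
  set C := generatedOrbit Q.opposite τ h
  have hno {a c : Q.HalfEdge} (ha : a ∈ C) (hc : c ∉ C) (htail : Q.tail a.1 = Q.tail c.1)
      (h1 : a.1 ≠ c.1) (h2 : (τ a).1 ≠ (τ c).1) : False := by
    obtain ⟨τ', hτ', hss⟩ := hτ.exists_switch ha hc htail h1 h2
    exact (hmax τ' hτ').not_gt (Set.ncard_lt_ncard hss)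
  have hcl {a c : Q.HalfEdge} (ha : a ∈ C) (htail : Q.tail a.1 = Q.tail c.1) : c ∈ C := by
    by_contra hc
    by_cases h12 : a.1 ≠ c.1 ∧ (τ a).1 ≠ (τ c).1
    · exact hno ha hc htail h12.1 h12.2
    -- If joining `a` with `c` is forbidden, joining `a` with `τ c` and `τ a` with `c` is allowed:
    -- either coincidence of directed arcs excludes both coincidences for the other switch, because
    -- `τ` never pairs equal directed arcs.
    · have hτc : τ c ∉ C := fun hcon => hc (hτ.apply_apply c ▸ right_mem_generatedOrbit hcon)
      have hca := hτ.fst_ne a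
      have hcc := hτ.fst_ne c
      refine hno ha hτc (by rw [hτ.tail_eq, htail]) ?_ ?_
      · grind
      · rw [hτ.apply_apply]
        grind
  refine eq_univ_of_forall fun x => ?_
  have hreach (v : V) : ∀ y : Q.HalfEdge, Q.tail y.1 = v → y ∈ C := by
    induction Q.connected (Q.tail h.1) v with
    | refl => exact fun y hy => hcl mem_generatedOrbit_self hy.symm
    | tail _ he ih =>
      intro y hy
      obtain ⟨e, ⟨h1, h2⟩ | ⟨h1, h2⟩⟩ := he
      · exact hcl (left_mem_generatedOrbit (ih ((e, true), true) h1)) (h2.trans hy.symm)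
      · exact hcl (left_mem_generatedOrbit (ih ((e, false), true) h2)) (h1.trans hy.symm)
  exact hreach _ x rfl

/-- The walk is one cycle of `τ ∘ opposite`: cross the arc, then leave by the partner of the end
reached. Reversing would mean leaving along a copy of the directed arc pointing back, which a
transition rules out. -/
theorem exists_nonreversing_walk [Finite A] [Nonempty A] (Q : Network V A)
    (hQ : ∀ a, ¬ Q.IsLeafArc a) : ∃ (n : ℕ) (d : Fin (n + 1) → Q.Dart), Q.IsClosedWalk d ∧
      (∀ a : A, {i | (d i).1 = a}.ncard = 2) ∧ ∀ i, d (i + 1) ≠ Q.reverse (d i) := by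
  obtain ⟨a₀⟩ := ‹Nonempty A›
  let h : Q.HalfEdge := ((a₀, true), true)
  obtain ⟨τ, hτ, huniv⟩ := Q.exists_isTransition_generatedOrbit_eq_univ hQ h
  have hne (x) : τ x ≠ x := fun he => hτ.fst_ne x (congrArg Prod.fst he)
  have hmem := mem_iterate_orbit_iff Q.opposite_opposite Q.opposite_ne hτ.apply_apply hne huniv
  set π := τ ∘ Q.opposite with hπ
  have hinj : Function.Injective π :=
    τ.injective.comp (Function.LeftInverse.injective Q.opposite_opposite)
  have hper := Function.minimalPeriod_pos_of_mem_periodicPts (hinj.mem_periodicPts h)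
  obtain ⟨n, hn⟩ : ∃ n, Function.minimalPeriod π h = n + 1 :=
    ⟨Function.minimalPeriod π h - 1, by omega⟩
  have hnext (i : Fin (n + 1)) : π^[(i + 1 : Fin (n + 1))] h = π (π^[i] h) := by
    rw [← Function.iterate_succ_apply' π]
    rcases eq_or_ne i (Fin.last n) with rfl | hi
    · have := Function.iterate_minimalPeriod (f := π) (x := h)
      rw [hn] at this
      simp [this]
    · rw [Fin.val_add_one_of_lt (Fin.lt_last_iff_ne_last.mpr hi)]
  refine ⟨n, fun i => (π^[i] h).1, fun i => ?_, fun a => ?_, fun i => ?_⟩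
  · beta_reduce
    rw [hnext, hπ, Function.comp_apply, hτ.tail_eq]
    exact (Q.tail_reverse _).symm
  · have hpinj : Function.Injective fun i : Fin (n + 1) => π^[i] h := fun i j hij =>
      Fin.ext (Function.iterate_injOn_Iio_minimalPeriod (by rw [hn]; exact i.2)
        (by rw [hn]; exact j.2) hij)
    have hrange : range (fun i : Fin (n + 1) => π^[i] h) = range (fun k => π^[k] h) := by
      ext x
      constructor
      · rintro ⟨i, rfl⟩
        exact ⟨i, rfl⟩
      · rintro ⟨k, rfl⟩
        refine ⟨⟨k % (n + 1), Nat.mod_lt _ n.succ_pos⟩, ?_⟩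
        have := Function.iterate_mod_minimalPeriod_eq (f := π) (x := h) (n := k)
        rwa [hn] at this
    -- Each copy `k` of the arc is traversed in exactly one direction `b`, so the two copies give
    -- exactly two indices.
    have hb (k : Bool) : ∃ b : Bool, ((a, b), k) ∈ range (fun k => π^[k] h) ∧
        ((a, !b), k) ∉ range (fun k => π^[k] h) := by
      have := hmem ((a, true), k)
      simp only [opposite, reverse, Bool.not_true] at this
      by_cases hk : ((a, true), k) ∈ range (fun k => π^[k] h)
      · exact ⟨true, hk, fun hk' => this.mp hk' hk⟩
      · exact ⟨false, this.mpr hk, hk⟩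
    obtain ⟨b₀, h₀, h₀'⟩ := hb false
    obtain ⟨b₁, h₁, h₁'⟩ := hb true
    rw [← Set.ncard_image_of_injective _ hpinj, Set.ncard_eq_two]
    refine ⟨((a, b₀), false), ((a, b₁), true), by simp, ?_⟩
    ext x
    simp only [mem_image, mem_ofPred_eq, mem_insert_iff, mem_singleton_iff]
    constructor
    · rintro ⟨i, hi, rfl⟩
      have hxi : π^[i] h ∈ range (fun k => π^[k] h) := ⟨i, rfl⟩
      generalize π^[i] h = x at hi hxi
      obtain ⟨⟨a', b⟩, k⟩ := x
      cases hi
      cases k <;> cases b <;> cases b₀ <;> cases b₁ <;> simp_all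
    · rintro (rfl | rfl)
      · obtain ⟨i, hi⟩ := hrange ▸ h₀
        exact ⟨i, congrArg (fun x => x.1.1) hi, hi⟩
      · obtain ⟨i, hi⟩ := hrange ▸ h₁
        exact ⟨i, congrArg (fun x => x.1.1) hi, hi⟩
  · beta_reduce
    rw [hnext, hπ, Function.comp_apply]
    exact hτ.fst_ne _

/-! ### From a closed walk to a unit-speed closed path -/

theorem lipschitzWith_dartPoint (Q : Network V A) (d : Q.Dart) :
    LipschitzWith 1 (Q.dartPoint d) := by
  obtain ⟨a, b⟩ := d
  cases b
  · simpa using! (Q.lipschitzWith_arcPoint a).comp (lipschitzWith_const_sub (Q.length a))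
  · simpa using! Q.lipschitzWith_arcPoint a

/-- The unit speed path along a walk. -/
theorem exists_path (Q : Network V A) {D : ℕ → Q.Dart}
    (hD : ∀ k, Q.head (D k) = Q.tail (D (k + 1))) (m : ℕ) : ∃ f : ℝ → Q.Point,
      LipschitzOnWith 1 f (Icc 0 (Q.walkLength D m)) ∧
      ∀ k < m, ∀ s ∈ Icc 0 (Q.length (D k).1), f (Q.walkLength D k + s) = Q.dartPoint (D k) s := by
  classical
  induction m with
  | zero => exact ⟨fun _ => .node (Q.tail (D 0)), (LipschitzWith.const _).lipschitzOnWith.weaken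
      zero_le_one, by simp⟩
  | succ m ih =>
    obtain ⟨f, hf, hfk⟩ := ih
    have hmono := Q.monotone_walkLength D
    have h0 : 0 ≤ Q.walkLength D m := by simpa [walkLength] using hmono (Nat.zero_le m)
    let F : ℝ → Q.Point := fun t =>
      if t < Q.walkLength D m then f t else Q.dartPoint (D m) (t - Q.walkLength D m)
    have hF2 : ∀ t, Q.walkLength D m ≤ t → F t = Q.dartPoint (D m) (t - Q.walkLength D m) :=
      fun t ht => if_neg ht.not_gt
    -- The two pieces agree at the joint because consecutive directed arcs share a node. For `m = 0`
    -- there is no preceding arc to compare with, and the first interval is a single point.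
    have hF1 : 0 < m → ∀ t, t ≤ Q.walkLength D m → F t = f t := by
      intro hm t ht
      rcases eq_or_lt_of_le ht with rfl | ht
      · obtain ⟨k, rfl⟩ := Nat.exists_eq_add_of_le' hm
        rw [hF2 _ le_rfl, sub_self, dartPoint_zero, ← hD, ← dartPoint_length,
          ← hfk k (by omega) _ ⟨(Q.length_pos _).le, le_rfl⟩, walkLength_succ]
      · exact if_pos ht
    refine ⟨F, ?_, fun k hk s hs => ?_⟩
    · refine ClosedPath.lipschitz_glue (b := Q.walkLength D m) ?_ ?_
      · rcases Nat.eq_zero_or_pos m with rfl | hm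
        · intro x hx y hy
          simp only [walkLength, Finset.range_zero, Finset.sum_empty, Icc_self,
            mem_singleton_iff] at hx hy
          simp [hx, hy]
        · intro x hx y hy
          rw [hF1 hm x hx.2, hF1 hm y hy.2]
          exact hf hx hy
      · intro x hx y hy
        rw [hF2 x hx.1, hF2 y hy.1]
        refine (Q.lipschitzWith_dartPoint (D m) _ _).trans_eq ?_
        rw [edist_sub_right]
    · rcases Nat.lt_succ_iff_lt_or_eq.mp hk with hk | rfl
      · rw [hF1 (by omega), hfk k hk s hs]
        have := hmono (Nat.succ_le_of_lt hk)
        rw [Nat.succ_eq_add_one, walkLength_succ] at this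
        linarith [hs.2]
      · rw [hF2 _ (by linarith [hs.1]), add_sub_cancel_left]

theorem IsClosedWalk.exists_traverses {Q : Network V A} {n : ℕ} {d : Fin (n + 1) → Q.Dart}
    (hd : Q.IsClosedWalk d) : ∃ S : Q.ClosedPath, S.Traverses d := by
  obtain ⟨f, hf, hfk⟩ := Q.exists_path hd.head_unroll (n + 1)
  have hmono := Q.monotone_walkLength (Q.unroll d)
  have hw0 : Q.walkLength (Q.unroll d) 0 = 0 := by simp [walkLength]
  have hpos : 0 < Q.walkLength (Q.unroll d) (n + 1) := by
    rw [walkLength_unroll_eq_sum]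
    exact Finset.sum_pos (fun i _ => Q.length_pos _) Finset.univ_nonempty
  have hclosed : f 0 = f (Q.walkLength (Q.unroll d) (n + 1)) := by
    have h0 := hfk 0 n.succ_pos 0 ⟨le_rfl, (Q.length_pos _).le⟩
    have h1 := hfk n n.lt_succ_self _ ⟨(Q.length_pos _).le, le_rfl⟩
    rw [hw0, add_zero, dartPoint_zero] at h0
    rw [walkLength_succ, h1, h0, dartPoint_length, hd.head_unroll]
    have := Q.unroll_add d 0
    rw [zero_add] at this
    rw [this]
  refine ⟨⟨_, hpos, f, hf, hclosed⟩, Q.walkLength_unroll_eq_sum d, 0, fun i s hs => ?_⟩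
  rw [zero_add, ← walkLength_unroll_val]
  have h1 := hfk i i.2 s (by rwa [unroll_val])
  rw [unroll_val] at h1
  rw [← h1, ClosedPath.periodic_eq _ 0]
  · simp
  · have h2 := hmono (Nat.succ_le_of_lt i.2)
    have h3 := hmono (Nat.zero_le i)
    rw [Nat.succ_eq_add_one, walkLength_succ, unroll_val] at h2
    rw [hw0] at h3
    constructor
    · simpa using add_nonneg h3 hs.1
    · simp only [Int.cast_zero, zero_add, one_mul]
      linarith [hs.2]

theorem exists_isNonreversingDoubleCover [Finite A] [Nonempty A] (Q : Network V A)
    (hQ : ∀ a, ¬ Q.IsLeafArc a) : ∃ S : Q.ClosedPath, S.IsNonreversingDoubleCover := by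
  obtain ⟨n, d, hd, h2, hrev⟩ := Q.exists_nonreversing_walk hQ
  obtain ⟨S, hS⟩ := hd.exists_traverses
  exact ⟨S, n, d, hd, h2, hrev, hS⟩

/-- Maximin never exceeds minimax, so a pair of strategies guaranteeing the same number closes the
gap. -/
theorem hasValue_of_forall {Q : Network V A} {α : ℝ} {v : ℝ≥0∞}
    {σ : ProbabilityMeasure Q.Patrol} (hσ : ∀ ν, v ≤ Q.payoff α σ ν)
    {ν : ProbabilityMeasure Q.Attack} (hν : ∀ σ, Q.payoff α σ ν ≤ v) : Q.HasValue α v := by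
  have h1 : v ≤ Q.lowerValue α := le_iSup_of_le σ (le_iInf hσ)
  have h2 : Q.upperValue α ≤ v := iInf_le_of_le ν (iSup_le hν)
  have h3 : Q.lowerValue α ≤ Q.upperValue α :=
    iSup_le fun σ => le_iInf fun ν => (iInf_le _ ν).trans (le_iSup (fun σ => Q.payoff α σ ν) σ)
  exact ⟨le_antisymm (h3.trans h2) h1, le_antisymm h2 (h1.trans h3)⟩

end Network

end

theorem mainTheorem3 {V A : Type*} [Finite V] [Fintype A] [Nonempty A] (Q : Network V A)
    (hQ : ∀ a, ¬ Q.IsLeafArc a) (α : ℝ) (hα : 0 < α) (hg : ENNReal.ofReal α ≤ Q.girth) :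
    Q.HasValue α (ENNReal.ofReal (α / Q.totalLength)) ∧
    (∀ M : ℝ≥0, Q.IsOptimalAttack α (Q.uniformAttack M)) ∧
    (∃ S : Q.ClosedPath, S.IsNonreversingDoubleCover) ∧
    (∀ S : Q.ClosedPath, S.IsNonreversingDoubleCover →
      Q.IsOptimalPatrol α S.randomizedExtension) := by
  obtain ⟨S, hS⟩ := Q.exists_isNonreversingDoubleCover hQ
  have hV : Q.HasValue α (ENNReal.ofReal (α / Q.totalLength)) :=
    Network.hasValue_of_forall (hS.le_payoff hα hg) (Q.payoff_uniformAttack_le hα 0)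
  exact ⟨hV, fun M => ⟨_, hV, Q.payoff_uniformAttack_le hα M⟩, ⟨S, hS⟩,
    fun T hT => ⟨_, hV, hT.le_payoff hα hg⟩⟩
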